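/- Let $n\ge 0$. For a finite field $\mathbb F_q$, let $\Xi_n=\{e_1-e_2,\dots,e_{n-1}-e_n\}$ be the set of simple roots of $GL_n$ (with respect to the diagonal torus and the upper triangular Borel subgroup). For $J\subseteq\Xi_n$ let $P_J\subseteq GL_n$ be the standard parabolic subgroup, that is, the stabilizer of the flag obtained from the standard full flag $E_1\subset\dots\subset E_{n-1}$ of $\mathbb F_q^n$ by removing $E_j$ whenever $e_j-e_{j+1}\in J$, and let $$Sp_{GL_n}(J)(\mathbb F_q)=\{(x,P): P \text{ is } GL_n(\mathbb F_q)\text{-conjugate to } P_J,\ x\in \mathrm{Lie}(P)\subseteq \mathfrak{gl}_n(\mathbb F_q)\text{ is a nilpotent matrix}\}.$$ Let $[Sp_{GL_n}]$ be the function $J\mapsto |Sp_{GL_n}(J)(\mathbb F_q)|$ on subsets of $\Xi_n$. Call $J_1,J_2$ associates if $\Phi(J_2)=w\,\Phi(J_1)$ for some $w\in S_n$, where $\Phi(J)$ is the set of roots $e_a-e_b$ ($a\ne b$) in the integral span of $J$; let $\delta_{[J_0]}$ be the indicator function of the associate class of $J_0$. For a partition $\nu=(\nu_1\ge\dots\ge\nu_l)$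 of $n$ put $J(\nu)=\{e_j-e_{j+1}: 1\le j\le n-1,\ j\ne \nu_1+\dots+\nu_k \text{ for all } k\}$. Let $\mathrm{Sym}_{\mathbb Q(q)}[X]$ be the ring of symmetric functions in infinitely many variables $X=(x_1,x_2,\dots)$ over $\mathbb Q(q)$, with $q$ an indeterminate, and with $m_\nu$, $h_n$, $p_k$ the monomial, complete homogeneous and power sum symmetric functions. For $k\ge1$ let $p_k$ also denote the ring endomorphism of $\mathrm{Sym}_{\mathbb Q(q)}[X]$ that fixes $\mathbb Q$ and maps $q\mapsto q^k$, $x_i\mapsto x_i^k$. For $F=f(p_1,p_2,\dots)\in\mathrm{Sym}_{\mathbb Q}[X]$ with $f$ a polynomial over $\mathbb Q$, and $y\in\mathrm{Sym}_{\mathbb Q(q)}[X]$, put $F[y]=f(p_1(y),p_2(y),\dots)$; write $X$ also for $x_1+x_2+\cdots$. Then there are polynomials $G\in\mathbb Z[q]$ and $S_\nu\in\mathbb Z[q]$ ($\nu$ a partition of $n$) such that for every finite field $\mathbb F_q$ $$|GL_n(\mathbb F_q)|=G(q),\qquad [Sp_{GL_n}]=\sum_{\nu\vdash n}S_\nu(q)\,\delta_{[J(\nu)]},$$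 and such that in $\mathrm{Sym}_{\mathbb Q(q)}[X]$ $$h_n\!\left[\frac{X}{q-1}\right]=\frac1{G}\sum_{\nu\vdash n}S_\nu\, m_\nu .$$ In other words, under the identification $m_\nu\leftrightarrow\delta_{[J(\nu)]}$ one has $h_n[X/(q-1)]=[Sp_{GL_n}]/|GL_n(\mathbb F_q)|$. -/

import Mathlib

open Polynomial

universe u

/-! ## Lambda rings and plethysm -/

/-- A lambda ring structure on a commutative `ℚ`-algebra `Λ`: ring endomorphisms `p_k`, `k ≥ 1`,
with `p_1 = id` and `p_m ∘ p_k = p_{mk}`. -/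
class LambdaRing (Λ : Type*) [CommRing Λ] [Algebra ℚ Λ] where
  /-- the operation `p_k` -/
  adams : ℕ+ → Λ →+* Λ
  adams_one : ∀ x, adams 1 x = x
  adams_adams : ∀ m k x, adams m (adams k x) = adams (m * k) x

theorem expand_mem_nonZeroDivisors (k : ℕ+) :
    nonZeroDivisors ℚ[X] ≤ (nonZeroDivisors ℚ[X]).comap (Polynomial.expand ℚ (k : ℕ)) := by
  intro f hf
  rw [mem_nonZeroDivisors_iff_ne_zero] at hf
  rw [Submonoid.mem_comap, mem_nonZeroDivisors_iff_ne_zero]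
  exact (Polynomial.expand_ne_zero k.pos).2 hf

/-- The endomorphism `r(q) ↦ r(q ^ k)` of `ℚ(q)`. -/
noncomputable def ratFuncAdams (k : ℕ+) : RatFunc ℚ →+* RatFunc ℚ :=
  RatFunc.mapRingHom (Polynomial.expand ℚ (k : ℕ)) (expand_mem_nonZeroDivisors k)

theorem ratFuncAdams_div (k : ℕ+) (f g : ℚ[X]) :
    ratFuncAdams k (algebraMap ℚ[X] (RatFunc ℚ) f / algebraMap ℚ[X] (RatFunc ℚ) g) =
      algebraMap ℚ[X] (RatFunc ℚ) (Polynomial.expand ℚ (k : ℕ) f) /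
        algebraMap ℚ[X] (RatFunc ℚ) (Polynomial.expand ℚ (k : ℕ) g) := by
  rw [ratFuncAdams, RatFunc.coe_mapRingHom_eq_coe_map, RatFunc.map_apply_div]

/-- The lambda ring structure on `ℚ(q)`: `p_k` fixes `ℚ` and maps `q` to `q ^ k`. -/
noncomputable instance : LambdaRing (RatFunc ℚ) where
  adams := ratFuncAdams
  adams_one x := by
    induction x using RatFunc.induction_on with
    | f p q hq => rw [ratFuncAdams_div]; simp
  adams_adams m k x := by
    induction x using RatFunc.induction_on with
    | f p q hq =>
      rw [ratFuncAdams_div, ratFuncAdams_div, ratFuncAdams_div, Polynomial.expand_expand,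
        Polynomial.expand_expand, PNat.mul_coe]

/-! ## Symmetric functions in infinitely many variables -/

section SymmetricFunctions

variable (R : Type*) [CommRing R]

/-- The ring `Sym_R[X]` of symmetric functions in the variables `X = (x_0, x_1, x_2, …)` over `R`:
formal power series of bounded degree that are invariant under all permutations of the
variables. -/
noncomputable def SymFun : Subalgebra R (MvPowerSeries ℕ R) where
  carrier := {f | (∀ σ : Equiv.Perm ℕ, MvPowerSeries.renameEquiv R σ f = f) ∧
    ∃ d : ℕ, ∀ m : ℕ →₀ ℕ, d < m.degree → MvPowerSeries.coeff m f = 0}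
  mul_mem' := by
    rintro f g ⟨hf, d, hd⟩ ⟨hg, e, he⟩
    refine ⟨fun σ => by rw [map_mul, hf, hg], d + e, fun m hm => ?_⟩
    classical
    rw [MvPowerSeries.coeff_mul]
    refine Finset.sum_eq_zero fun x hx => ?_
    have hx' : x.1 + x.2 = m := Finset.HasAntidiagonal.mem_antidiagonal.1 hx
    have h : x.1.degree + x.2.degree = m.degree := by rw [← hx', map_add]
    by_cases h1 : d < x.1.degree
    · rw [hd _ h1, zero_mul]
    · rw [he _ (by omega), mul_zero]
  add_mem' := by
    rintro f g ⟨hf, d, hd⟩ ⟨hg, e, he⟩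
    refine ⟨fun σ => by rw [map_add, hf, hg], max d e, fun m hm => ?_⟩
    rw [max_lt_iff] at hm
    rw [map_add, hd m hm.1, he m hm.2, add_zero]
  algebraMap_mem' r := by
    classical
    refine ⟨fun σ => AlgEquiv.commutes _ r, 0, fun m hm => ?_⟩
    rw [MvPowerSeries.algebraMap_apply, MvPowerSeries.coeff_C, if_neg]
    rintro rfl
    simp at hm

variable {R}

noncomputable instance symFunRatAlgebra [Algebra ℚ R] : Algebra ℚ (SymFun R) :=
  Subalgebra.algebra' (SymFun R)

theorem coeff_equivMapDomain_renameEquiv (σ : Equiv.Perm ℕ) (f : MvPowerSeries ℕ R)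
    (m : ℕ →₀ ℕ) :
    MvPowerSeries.coeff (m.equivMapDomain σ) (MvPowerSeries.renameEquiv R σ f) =
      MvPowerSeries.coeff m f := by
  have h := MvPowerSeries.coeff_embDomain_rename (R := R) σ.toEmbedding f m
  rw [Finsupp.embDomain_eq_mapDomain] at h
  rw [Finsupp.equivMapDomain_eq_mapDomain, MvPowerSeries.renameEquiv_apply]
  exact h

theorem renameEquiv_eq_self_iff (σ : Equiv.Perm ℕ) (f : MvPowerSeries ℕ R) :
    MvPowerSeries.renameEquiv R σ f = f ↔
      ∀ m : ℕ →₀ ℕ, MvPowerSeries.coeff (m.equivMapDomain σ) f = MvPowerSeries.coeff m f := by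
  constructor
  · intro h m
    conv_lhs => rw [← h]
    exact coeff_equivMapDomain_renameEquiv σ f m
  · intro h
    ext m
    have h1 : (m.equivMapDomain σ.symm).equivMapDomain σ = m := by
      ext i; simp [Finsupp.equivMapDomain_apply]
    rw [← h1, coeff_equivMapDomain_renameEquiv, h]

theorem degree_equivMapDomain (σ : Equiv.Perm ℕ) (m : ℕ →₀ ℕ) :
    (m.equivMapDomain σ).degree = m.degree := by
  rw [Finsupp.equivMapDomain_eq_mapDomain, Finsupp.degree_mapDomain]

/-- The multiset of the non-zero exponents of the monomial `x ^ m`. -/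
def exponents (m : ℕ →₀ ℕ) : Multiset ℕ := m.support.val.map m

theorem exponents_equivMapDomain (σ : Equiv.Perm ℕ) (m : ℕ →₀ ℕ) :
    exponents (m.equivMapDomain σ) = exponents m := by
  have h : (m.equivMapDomain σ).support = m.support.map σ.toEmbedding := rfl
  rw [exponents, h, Finset.map_val, Multiset.map_map]
  refine Multiset.map_congr rfl fun i _ => ?_
  simp [Finsupp.equivMapDomain_apply]

theorem sum_exponents (m : ℕ →₀ ℕ) : (exponents m).sum = m.degree := rfl

/-- The power series whose coefficient at `x ^ m` is `c (exponents m)`. -/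
def exponentSeries (c : Multiset ℕ → R) : MvPowerSeries ℕ R := fun m => c (exponents m)

theorem coeff_exponentSeries (c : Multiset ℕ → R) (m : ℕ →₀ ℕ) :
    MvPowerSeries.coeff m (exponentSeries c) = c (exponents m) := rfl

/-- A power series of bounded degree whose coefficient at `x ^ m` depends only on the multiset of
non-zero exponents of `x ^ m` is a symmetric function. -/
noncomputable def SymFun.ofExponents (c : Multiset ℕ → R) (d : ℕ)
    (hc : ∀ s : Multiset ℕ, d < s.sum → c s = 0) : SymFun R :=
  ⟨exponentSeries c, fun σ => (renameEquiv_eq_self_iff σ _).2 fun m => by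
    rw [coeff_exponentSeries, coeff_exponentSeries, exponents_equivMapDomain],
    d, fun m hm => by
      rw [coeff_exponentSeries]
      exact hc _ hm⟩

variable (R)

/-- The complete homogeneous symmetric function `h_n`, the sum of all monomials of degree `n`. -/
noncomputable def hSym (n : ℕ) : SymFun R :=
  SymFun.ofExponents (fun s => if s.sum = n then 1 else 0) n fun _ hs => if_neg (ne_of_gt hs)

/-- The power sum symmetric function `p_k = ∑_i x_i ^ k`, `k ≥ 1`: the monomials that occur are
those whose only non-zero exponent is `k`. -/
noncomputable def pSym (k : ℕ+) : SymFun R :=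
  SymFun.ofExponents (fun s => if s = {(k : ℕ)} then 1 else 0) k fun s hs => if_neg (by
    rintro rfl
    simp at hs)

/-- The monomial symmetric function `m_μ` of a partition `μ` of `n`, the sum of all monomials whose
non-zero exponents are the parts of `μ`. -/
noncomputable def mSym {n : ℕ} (μ : n.Partition) : SymFun R :=
  SymFun.ofExponents (fun s => if s = μ.parts then 1 else 0) n fun s hs => if_neg (by
    rintro rfl
    rw [μ.parts_sum] at hs
    exact lt_irrefl _ hs)

end SymmetricFunctions

section Plethysm

variable {R : Type*} [CommRing R]

theorem expand_map_mem_symFun (k : ℕ+) (φ : R →+* R) {f : MvPowerSeries ℕ R}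
    (hf : f ∈ SymFun R) :
    MvPowerSeries.expand (k : ℕ) k.ne_zero (MvPowerSeries.map φ f) ∈ SymFun R := by
  obtain ⟨hf, d, hd⟩ := hf
  refine ⟨fun σ => ?_, k * d, fun m hm => ?_⟩
  · rw [renameEquiv_eq_self_iff]
    intro m
    have key := (renameEquiv_eq_self_iff σ f).1 (hf σ)
    by_cases h : ∀ i, (k : ℕ) ∣ m i
    · obtain ⟨l, rfl⟩ : ∃ l : ℕ →₀ ℕ, (k : ℕ) • l = m :=
        ⟨m.mapRange (fun a => a / k) (by simp), by
          ext i; simp [Nat.mul_div_cancel' (h i)]⟩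
      have h1 : ((k : ℕ) • l).equivMapDomain σ = (k : ℕ) • l.equivMapDomain σ := by
        ext i; simp [Finsupp.equivMapDomain_apply]
      rw [h1, MvPowerSeries.coeff_expand_smul, MvPowerSeries.coeff_expand_smul,
        MvPowerSeries.coeff_map, MvPowerSeries.coeff_map, key]
    · push Not at h
      obtain ⟨i, hi⟩ := h
      rw [MvPowerSeries.coeff_expand_of_not_dvd _ _ _ hi,
        MvPowerSeries.coeff_expand_of_not_dvd (i := σ i)]
      simpa [Finsupp.equivMapDomain_apply] using hi
  · by_cases h : ∀ i, (k : ℕ) ∣ m i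
    · obtain ⟨l, rfl⟩ : ∃ l : ℕ →₀ ℕ, (k : ℕ) • l = m :=
        ⟨m.mapRange (fun a => a / k) (by simp), by
          ext i; simp [Nat.mul_div_cancel' (h i)]⟩
      rw [map_nsmul, smul_eq_mul] at hm
      rw [MvPowerSeries.coeff_expand_smul, MvPowerSeries.coeff_map,
        hd l (lt_of_mul_lt_mul_left' hm), map_zero]
    · push Not at h
      obtain ⟨i, hi⟩ := h
      rw [MvPowerSeries.coeff_expand_of_not_dvd _ _ _ hi]

/-- The endomorphism of `Sym_R[X]` that acts on the coefficients by `φ` and maps each variable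
`x_i` to `x_i ^ k`. -/
noncomputable def symAdams (k : ℕ+) (φ : R →+* R) : SymFun R →+* SymFun R :=
  (((MvPowerSeries.expand (k : ℕ) k.ne_zero : MvPowerSeries ℕ R →ₐ[R] _).toRingHom.comp
    (MvPowerSeries.map φ)).comp (SymFun R).val.toRingHom).codRestrict (SymFun R).toSubring
      fun f => expand_map_mem_symFun k φ f.2

variable [Algebra ℚ R] [LambdaRing R]

/-- The lambda ring structure on `Sym_R[X]` over a lambda ring `R`: `p_k` extends the operation
`p_k` of `R` and maps `x_i` to `x_i ^ k`, so that it maps the power sum `p_m` to `p_{km}`. -/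
noncomputable instance : LambdaRing (SymFun R) where
  adams k := symAdams k (LambdaRing.adams k)
  adams_one f := by
    have h : (LambdaRing.adams 1 : R →+* R) = RingHom.id R :=
      RingHom.ext LambdaRing.adams_one
    apply Subtype.ext
    change MvPowerSeries.expand 1 one_ne_zero (MvPowerSeries.map (LambdaRing.adams 1) f.1) = f.1
    rw [h, MvPowerSeries.map_id, MvPowerSeries.expand_one_apply]
    rfl
  adams_adams m k f := by
    have h : (LambdaRing.adams (m * k) : R →+* R) =
        (LambdaRing.adams m).comp (LambdaRing.adams k) :=
      RingHom.ext fun x => (LambdaRing.adams_adams m k x).symm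
    apply Subtype.ext
    change MvPowerSeries.expand (m : ℕ) m.ne_zero (MvPowerSeries.map (LambdaRing.adams m)
        (MvPowerSeries.expand (k : ℕ) k.ne_zero (MvPowerSeries.map (LambdaRing.adams k) f.1))) =
      MvPowerSeries.expand ((m : ℕ) * k) (mul_ne_zero m.ne_zero k.ne_zero)
        (MvPowerSeries.map (LambdaRing.adams (m * k)) f.1)
    rw [h, MvPowerSeries.map_expand, MvPowerSeries.expand_mul, MvPowerSeries.map_comp]
    rfl

theorem adams_algebraMap (k : ℕ+) (r : R) :
    LambdaRing.adams k (algebraMap R (SymFun R) r) =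
      algebraMap R (SymFun R) (LambdaRing.adams k r) := by
  apply Subtype.ext
  change MvPowerSeries.expand (k : ℕ) k.ne_zero (MvPowerSeries.map (LambdaRing.adams k)
    (MvPowerSeries.C r)) = MvPowerSeries.C (LambdaRing.adams k r)
  rw [MvPowerSeries.map_C, MvPowerSeries.expand_C]

open Classical in
/-- The plethystic action `F[x]` of a symmetric function `F` with rational coefficients on an
element `x` of a lambda ring: write `F = f(p_1, p_2, …)` as a polynomial in the power sums (which
is possible in exactly one way) and put `F[x] = f(p_1(x), p_2(x), …)`. -/
noncomputable def plethysm {Λ : Type*} [CommRing Λ] [Algebra ℚ Λ] [LambdaRing Λ]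
    (F : SymFun ℚ) (x : Λ) : Λ :=
  if h : ∃ f : MvPolynomial ℕ+ ℚ, MvPolynomial.aeval (pSym ℚ) f = F then
    MvPolynomial.aeval (fun k : ℕ+ => LambdaRing.adams k x) h.choose
  else 0

end Plethysm

/-! ## Parabolic subgroups of `GL_n` and the Springer varieties -/

/-- A subgroup functor of `GL_n` over a field `F`: a subgroup of `GL_n(R)` for each commutative
`F`-algebra `R`. Closed `F`-subgroups of `GL_n` are identified with their functors of points. -/
abbrev GLSubgroup (n : ℕ) (F : Type u) [Field F] : Type (u + 1) :=
  ∀ (R : Type u) [CommRing R] [Algebra F R], Subgroup (GL (Fin n) R)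

/-- The term `E_j = ⟨e_1, …, e_j⟩` of the standard full flag in `R ^ n`. -/
def standardFlag (n : ℕ) (R : Type*) [CommRing R] (j : ℕ) : Submodule R (Fin n → R) where
  carrier := {v | ∀ a : Fin n, j ≤ (a : ℕ) → v a = 0}
  add_mem' := fun {v w} hv hw a ha => by rw [Pi.add_apply, hv a ha, hw a ha, add_zero]
  zero_mem' := fun _ _ => rfl
  smul_mem' := fun r v hv a ha => by rw [Pi.smul_apply, hv a ha, smul_zero]

/-- The subgroup of all `g ∈ GL_n(R)` with `g E = E`. -/
def submoduleStabilizer {n : ℕ} {R : Type*} [CommRing R] (E : Submodule R (Fin n → R)) :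
    Subgroup (GL (Fin n) R) where
  carrier := {g | E.map (Matrix.mulVecLin (g : Matrix (Fin n) (Fin n) R)) = E}
  mul_mem' := by
    intro g h hg hh
    rw [Set.mem_ofPred_eq] at hg hh ⊢
    rw [Units.val_mul, Matrix.mulVecLin_mul, Submodule.map_comp, hh, hg]
  one_mem' := by
    rw [Set.mem_ofPred_eq, Units.val_one, Matrix.mulVecLin_one, Submodule.map_id]
  inv_mem' := by
    intro g hg
    rw [Set.mem_ofPred_eq] at hg ⊢
    conv_lhs => rw [← hg]
    rw [← Submodule.map_comp, ← Matrix.mulVecLin_mul, ← Units.val_mul, inv_mul_cancel,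
      Units.val_one, Matrix.mulVecLin_one, Submodule.map_id]

/-- The standard parabolic subgroup `P_J` of `GL_n`. The index `i : Fin (n - 1)` (`0 ≤ i < n - 1`)
stands for the simple root `e_{i+1} - e_{i+2}`, and `P_J` is the stabilizer of the flag obtained
from the standard full flag by removing the terms `E_{i+1}` with `i ∈ J`. -/
def standardParabolic (n : ℕ) (F : Type u) [Field F] (J : Set (Fin (n - 1))) : GLSubgroup n F :=
  fun R _ _ => ⨅ i ∈ Jᶜ, submoduleStabilizer (standardFlag n R ((i : ℕ) + 1))

/-- The conjugate `g P g⁻¹` of a subgroup `P` of `GL_n` by an element `g` of `GL_n(F)`. -/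
def conjSubgroup {n : ℕ} {F : Type u} [Field F] (g : GL (Fin n) F) (P : GLSubgroup n F) :
    GLSubgroup n F :=
  fun R _ _ =>
    (P R).map (MulAut.conj (Matrix.GeneralLinearGroup.map (algebraMap F R) g)).toMonoidHom

/-- The Lie algebra of a subgroup `P` of `GL_n`: the matrices `x` over `F` such that `1 + ε x` is
an `F[ε]`-point of `P`, where `ε ^ 2 = 0`. -/
def lieAlgebra {n : ℕ} {F : Type u} [Field F] (P : GLSubgroup n F) :
    Set (Matrix (Fin n) (Fin n) F) :=
  {x | ∃ g ∈ P (DualNumber F), (g : Matrix (Fin n) (Fin n) (DualNumber F)) =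
    1 + (DualNumber.eps : DualNumber F) • x.map (algebraMap F (DualNumber F))}

/-- The set of `F`-points of the generalized Springer variety `Sp_{GL_n}(J)`: pairs `(x, P)` where
`P` is a parabolic subgroup that is `F`-conjugate to `P_J` and `x` is a nilpotent element
of `Lie(P)`. -/
def springerVariety (n : ℕ) (F : Type u) [Field F] (J : Set (Fin (n - 1))) :
    Set (Matrix (Fin n) (Fin n) F × GLSubgroup n F) :=
  {xP | (∃ g : GL (Fin n) F, xP.2 = conjSubgroup g (standardParabolic n F J)) ∧
    IsNilpotent xP.1 ∧ xP.1 ∈ lieAlgebra xP.2}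

/-- The function `[Sp_{GL_n}]`, which maps `J` to the number of `F`-points of `Sp_{GL_n}(J)`. -/
noncomputable def springerCount (n : ℕ) (F : Type u) [Field F] (J : Set (Fin (n - 1))) : ℤ :=
  Nat.card (springerVariety n F J)

/-! ## Associate classes of sets of simple roots of `GL_n` -/

/-- The root `e_a - e_b` of `GL_n` as a vector in `ℤ ^ n`. -/
def glRoot (n : ℕ) (a b : Fin n) : Fin n → ℤ := Pi.single a 1 - Pi.single b 1

/-- The simple root with index `i : Fin (n - 1)`, that is, `e_{i+1} - e_{i+2}` if the coordinates
are numbered from `1`. -/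
def glSimpleRoot (n : ℕ) (i : Fin (n - 1)) : Fin n → ℤ :=
  glRoot n ⟨i, by omega⟩ ⟨i + 1, by omega⟩

/-- The root system `Φ(J)` of the standard Levi subgroup `L_J`: the roots of `GL_n` that are
integral linear combinations of the simple roots in `J`. -/
def leviRoots (n : ℕ) (J : Set (Fin (n - 1))) : Set (Fin n → ℤ) :=
  {r | (∃ a b, a ≠ b ∧ r = glRoot n a b) ∧ r ∈ AddSubgroup.closure (glSimpleRoot n '' J)}

/-- `J₁` and `J₂` are associates: `Φ(J₂) = w Φ(J₁)` for some `w` in the Weyl group `S_n`. -/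
def AreAssociate (n : ℕ) (J₁ J₂ : Set (Fin (n - 1))) : Prop :=
  ∃ w : Equiv.Perm (Fin n), leviRoots n J₂ = (fun r => r ∘ w.symm) '' leviRoots n J₁

open Classical in
/-- The function `δ_{[J₀]}`: it is `1` on the associate class of `J₀` and `0` elsewhere. -/
noncomputable def assocDelta (n : ℕ) (J₀ J : Set (Fin (n - 1))) : ℤ :=
  if AreAssociate n J₀ J then 1 else 0

/-- For a partition `ν = (ν_1 ≥ ν_2 ≥ …)` of `n`, the set `J(ν)` of all simple roots
`e_j - e_{j+1}`, `1 ≤ j ≤ n - 1`, such that `j` is none of the partial sums `ν_1 + … + ν_k`. -/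
def partitionRoots {n : ℕ} (ν : n.Partition) : Set (Fin (n - 1)) :=
  {i | ∀ k : ℕ, ((ν.parts.sort (· ≥ ·)).take k).sum ≠ (i : ℕ) + 1}

/-- An integer polynomial in `q`, viewed as an element of `ℚ(q)`. -/
noncomputable def toRatFunc (f : ℤ[X]) : RatFunc ℚ :=
  algebraMap ℚ[X] (RatFunc ℚ) (f.map (Int.castRingHom ℚ))

theorem exponents_eq_singleton_iff {k : ℕ} (hk : k ≠ 0) (m : ℕ →₀ ℕ) :
    exponents m = {k} ↔ ∃ i, m = Finsupp.single i k := by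
  constructor
  · intro h
    have hc : m.support.card = 1 := by
      have := congrArg Multiset.card h
      simpa [exponents] using this
    obtain ⟨i, b, hb, rfl⟩ := Finsupp.card_support_eq_one'.1 hc
    refine ⟨i, ?_⟩
    rw [exponents, Finsupp.support_single _ hb] at h
    simp at h
    rw [h]
  · rintro ⟨i, rfl⟩
    rw [exponents, Finsupp.support_single _ hk]
    simp

theorem coeff_pSym (R : Type*) [CommRing R] (k : ℕ+) (m : ℕ →₀ ℕ) :
    MvPowerSeries.coeff m (pSym R k : MvPowerSeries ℕ R) =
      if exponents m = {(k : ℕ)} then 1 else 0 := rfl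

theorem coeff_hSym (R : Type*) [CommRing R] (n : ℕ) (m : ℕ →₀ ℕ) :
    MvPowerSeries.coeff m (hSym R n : MvPowerSeries ℕ R) = if m.degree = n then 1 else 0 := rfl

/-- The values of the power sums at a finite list of numbers. -/
def powerSums (l : List ℚ) (k : ℕ+) : ℚ := (l.map (· ^ (k : ℕ))).sum

theorem hasSubst_list (l : List ℚ) :
    MvPowerSeries.HasSubst
      (fun i : ℕ => (MvPowerSeries.C (l.getD i 0) * MvPowerSeries.X () : MvPowerSeries Unit ℚ)) where
  const_coeff s := by simp
  coeff_zero d := by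
    refine (Set.finite_lt_nat l.length).subset fun i hi => ?_
    by_contra h
    apply hi
    simp only [Set.mem_ofPred_eq, not_lt] at h
    simp [List.getD, h]

theorem subst_pSym (l : List ℚ) (k : ℕ+) :
    MvPowerSeries.subst (fun i : ℕ =>
      (MvPowerSeries.C (l.getD i 0) * MvPowerSeries.X () : MvPowerSeries Unit ℚ))
      (pSym ℚ k : MvPowerSeries ℕ ℚ) =
      MvPowerSeries.C (powerSums l k) * MvPowerSeries.X () ^ (k : ℕ) := by
  set a : ℕ → MvPowerSeries Unit ℚ := fun i : ℕ =>
      (MvPowerSeries.C (l.getD i 0) * MvPowerSeries.X () : MvPowerSeries Unit ℚ) with ha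
  have hs : MvPowerSeries.HasSubst a := hasSubst_list l
  set S : MvPowerSeries ℕ ℚ := ∑ i ∈ Finset.range l.length, MvPowerSeries.X i ^ (k : ℕ) with hS
  have h1 : MvPowerSeries.subst a ((pSym ℚ k : MvPowerSeries ℕ ℚ) - S) = 0 := by
    refine MvPowerSeries.ext fun e => ?_
    rw [MvPowerSeries.coeff_subst hs, map_zero, finsum_eq_zero_of_forall_eq_zero]
    intro d
    by_cases hd : ∃ i ∈ d.support, l.length ≤ i
    · obtain ⟨i, hi, hl⟩ := hd
      have : d.prod (fun s e => a s ^ e) = 0 := by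
        refine Finset.prod_eq_zero hi ?_
        have : a i = 0 := by simp [ha, List.getD, hl]
        change a i ^ d i = 0
        rw [this, zero_pow (Finsupp.mem_support_iff.1 hi)]
      rw [this, map_zero, smul_zero]
    · push Not at hd
      convert zero_smul ℚ _
      rw [map_sub, coeff_pSym, hS, map_sum, sub_eq_zero]
      simp_rw [MvPowerSeries.coeff_X_pow]
      by_cases h : exponents d = {(k : ℕ)}
      · obtain ⟨i, rfl⟩ := (exponents_eq_singleton_iff k.ne_zero d).1 h
        have hi : i < l.length := hd i (by simp)
        rw [if_pos h, Finset.sum_eq_single_of_mem i (Finset.mem_range.2 hi), if_pos rfl]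
        intro j _ hj
        rw [if_neg]
        intro he
        rw [Finsupp.single_left_inj k.ne_zero] at he
        exact hj he.symm
      · rw [if_neg h, Finset.sum_eq_zero]
        intro i _
        rw [if_neg]
        rintro rfl
        exact h ((exponents_eq_singleton_iff k.ne_zero _).2 ⟨i, rfl⟩)
  rw [MvPowerSeries.subst_sub hs, sub_eq_zero] at h1
  rw [h1, hS, ← MvPowerSeries.coe_substAlgHom hs, map_sum]
  simp_rw [map_pow, MvPowerSeries.substAlgHom_X, ha, mul_pow, ← map_pow]
  rw [← Finset.sum_mul, ← map_sum]
  congr 2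
  rw [powerSums]
  rw [← Fin.sum_univ_fun_getElem, Finset.sum_range]
  exact Finset.sum_congr rfl fun i _ => by simp

theorem aeval_powerSums_eq_zero {f : MvPolynomial ℕ+ ℚ} (hf : MvPolynomial.aeval (pSym ℚ) f = 0)
    (l : List ℚ) : MvPolynomial.aeval (powerSums l) f = 0 := by
  have hs := hasSubst_list l
  have h1 : MvPolynomial.aeval (fun k : ℕ+ => (MvPowerSeries.C (powerSums l k) *
      MvPowerSeries.X () ^ (k : ℕ) : MvPowerSeries Unit ℚ)) f = 0 := by
    have := congrArg ((MvPowerSeries.substAlgHom (R := ℚ) hs).comp (SymFun ℚ).val) hf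
    rw [map_zero, ← AlgHom.comp_apply, MvPolynomial.comp_aeval] at this
    rw [← this]
    congr 2
    ext1 k
    rw [AlgHom.comp_apply, MvPowerSeries.coe_substAlgHom, ← subst_pSym]
    rfl
  have h2 : MvPolynomial.aeval (fun k : ℕ+ => (MvPolynomial.C (powerSums l k) *
      MvPolynomial.X () ^ (k : ℕ) : MvPolynomial Unit ℚ)) f = 0 := by
    apply MvPolynomial.coe_injective Unit ℚ
    rw [MvPolynomial.coe_zero, ← h1]
    have := MvPolynomial.comp_aeval_apply (fun k : ℕ+ => (MvPolynomial.C (powerSums l k) *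
      MvPolynomial.X () ^ (k : ℕ) : MvPolynomial Unit ℚ))
      (MvPolynomial.coeToMvPowerSeries.algHom (R := ℚ) (σ := Unit) ℚ) f
    rw [MvPolynomial.coeToMvPowerSeries.algHom_apply] at this
    simp only [Algebra.algebraMap_self, MvPowerSeries.map_id, RingHom.id_apply] at this
    rw [this]
    congr 2
    ext1 k
    simp
  have := congrArg (MvPolynomial.aeval (fun _ : Unit => (1 : ℚ))) h2
  rw [map_zero, ← AlgHom.comp_apply, MvPolynomial.comp_aeval] at this
  rw [← this]
  congr 2
  ext1 k
  simp

theorem exists_powerSums_eq (K : ℕ) (t : Fin K → ℕ) :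
    ∃ l, ∀ k, powerSums l k = ∑ a : Fin K, (t a : ℚ) * ((a : ℚ) + 1) ^ (k : ℕ) := by
  refine ⟨(List.ofFn fun a : Fin K => List.replicate (t a) ((a : ℚ) + 1)).flatten, fun k => ?_⟩
  rw [powerSums, List.map_flatten, List.sum_flatten, List.map_map, List.map_ofFn, List.sum_ofFn]
  simp

/-- The power sums are algebraically independent over `ℚ`. -/
theorem algebraicIndependent_pSym : AlgebraicIndependent ℚ (pSym ℚ) := by
  rw [algebraicIndependent_iff]
  intro f hf
  obtain ⟨K, hK⟩ : ∃ K : ℕ, ∀ k ∈ f.vars, (k : ℕ) ≤ K :=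
    ⟨f.vars.sup fun k : ℕ+ => (k : ℕ), fun k hk => Finset.le_sup (f := fun k : ℕ+ => (k : ℕ)) hk⟩
  set g : MvPolynomial (Fin K) ℚ := MvPolynomial.bind₁ (fun k : ℕ+ =>
    ∑ a : Fin K, MvPolynomial.X a * MvPolynomial.C (((a : ℚ) + 1) ^ (k : ℕ))) f with hg
  have hge (x : Fin K → ℚ) : MvPolynomial.eval x g =
      MvPolynomial.eval (fun k : ℕ+ => ∑ a : Fin K, x a * ((a : ℚ) + 1) ^ (k : ℕ)) f := by
    rw [hg, MvPolynomial.eval, MvPolynomial.eval₂Hom_bind₁]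
    simp
  have hg0 : g = 0 := by
    refine MvPolynomial.funext_set (fun _ => Set.range ((↑) : ℕ → ℚ))
      (fun _ => Set.infinite_range_of_injective Nat.cast_injective) fun x hx => ?_
    choose t ht using fun i => hx i (Set.mem_univ i)
    obtain ⟨l, hl⟩ := exists_powerSums_eq K t
    rw [hge, map_zero, ← aeval_powerSums_eq_zero hf l, MvPolynomial.aeval_eq_eval]
    simp_rw [← ht]
    simp only [← hl]
  refine MvPolynomial.funext fun c => ?_
  set V : Matrix (Fin K) (Fin K) ℚ := Matrix.of fun a k => ((a : ℚ) + 1) ^ ((k : ℕ) + 1) with hV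
  have hdet : IsUnit V.det := by
    have : V = Matrix.diagonal (fun a : Fin K => (a : ℚ) + 1) *
        Matrix.vandermonde (fun a : Fin K => (a : ℚ) + 1) := by
      ext a k
      simp [hV, Matrix.diagonal_mul, Matrix.vandermonde_apply, pow_succ']
    rw [this, Matrix.det_mul, Matrix.det_diagonal, isUnit_iff_ne_zero]
    refine mul_ne_zero (Finset.prod_ne_zero_iff.2 fun a _ => by positivity) ?_
    rw [Matrix.det_vandermonde_ne_zero_iff]
    intro a b hab
    ext
    simpa using hab
  set x : Fin K → ℚ := Matrix.vecMul (fun k : Fin K => c ⟨k + 1, k.val.succ_pos⟩) V⁻¹ with hx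
  have hxV : Matrix.vecMul x V = fun k : Fin K => c ⟨k + 1, k.val.succ_pos⟩ := by
    rw [hx, Matrix.vecMul_vecMul, Matrix.nonsing_inv_mul _ hdet, Matrix.vecMul_one]
  rw [map_zero, ← map_zero (MvPolynomial.eval x), ← hg0, hge]
  refine MvPolynomial.eval₂Hom_congr' rfl (fun k hk _ => ?_) rfl
  have hk' := hK k hk
  have h2 := congrFun hxV ⟨k - 1, by have := k.pos; omega⟩
  have h1 : (k : ℕ) - 1 + 1 = k := Nat.sub_add_cancel k.pos
  rw [Matrix.vecMul, dotProduct] at h2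
  simp only [hV, Matrix.of_apply, h1] at h2
  exact h2.symm

section

variable {R : Type*} [CommRing R]

/-- The sum of all monomials `x ^ m` of degree `n`, weighted by the product of the numbers `c a`
over the non-zero exponents `a` of `x ^ m`. -/
noncomputable def weightedHSym (c : ℕ → R) (n : ℕ) : SymFun R :=
  SymFun.ofExponents (fun s => if s.sum = n then (s.map c).prod else 0) n
    fun _ hs => if_neg (ne_of_gt hs)

theorem coeff_weightedHSym {c : ℕ → R} (hc : c 0 = 1) (n : ℕ) {m : ℕ →₀ ℕ} {s : Finset ℕ}
    (hs : m.support ⊆ s) :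
    MvPowerSeries.coeff m (weightedHSym c n : MvPowerSeries ℕ R) =
      if m.degree = n then ∏ i ∈ s, c (m i) else 0 := by
  have h : ((exponents m).map c).prod = ∏ i ∈ s, c (m i) := by
    rw [exponents, Multiset.map_map]
    refine Finset.prod_subset hs fun i _ hi => ?_
    rw [Function.comp_apply, Finsupp.notMem_support_iff.1 hi, hc]
  rw [← h]
  rfl

theorem weightedHSym_one (n : ℕ) : weightedHSym (fun _ => (1 : R)) n = hSym R n := by
  apply Subtype.ext
  refine MvPowerSeries.ext fun m => ?_
  rw [coeff_weightedHSym rfl n subset_rfl, coeff_hSym, Finset.prod_const_one]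

theorem weightedHSym_zero {c : ℕ → R} (hc : c 0 = 1) : weightedHSym c 0 = 1 := by
  classical
  apply Subtype.ext
  refine MvPowerSeries.ext fun m => ?_
  rw [coeff_weightedHSym hc 0 subset_rfl, OneMemClass.coe_one, MvPowerSeries.coeff_one]
  by_cases h : m = 0
  · simp [h]
  · rw [if_neg h, if_neg]
    rwa [Finsupp.degree_eq_zero_iff]

theorem coeff_pSym_mul (k : ℕ+) (g : MvPowerSeries ℕ R) (m : ℕ →₀ ℕ) :
    MvPowerSeries.coeff m ((pSym R k : MvPowerSeries ℕ R) * g) =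
      ∑ i ∈ m.support, if (k : ℕ) ≤ m i then
        MvPowerSeries.coeff (m - Finsupp.single i (k : ℕ)) g else 0 := by
  classical
  rw [MvPowerSeries.coeff_mul, ← Finset.sum_filter]
  symm
  refine Finset.sum_of_injOn (fun i => (Finsupp.single i (k : ℕ), m - Finsupp.single i (k : ℕ)))
    ?_ ?_ ?_ ?_
  · intro i _ j _ hij
    simpa [Finsupp.single_left_inj k.ne_zero] using congrArg Prod.fst hij
  · intro i hi
    simp only [Finset.coe_filter, Set.mem_ofPred_eq] at hi
    rw [Finset.mem_coe, Finset.HasAntidiagonal.mem_antidiagonal]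
    exact add_tsub_cancel_of_le (Finsupp.single_le_iff.2 hi.2)
  · rintro ⟨x, y⟩ hxy hn
    rw [Finset.HasAntidiagonal.mem_antidiagonal] at hxy
    simp only at hxy ⊢
    rw [coeff_pSym, if_neg, zero_mul]
    intro h
    obtain ⟨i, rfl⟩ := (exponents_eq_singleton_iff k.ne_zero x).1 h
    apply hn
    have hk := k.pos
    refine ⟨i, ?_, ?_⟩
    · rw [← hxy, Finset.mem_coe, Finset.mem_filter, Finsupp.mem_support_iff]
      simp
    · rw [← hxy]
      simp
  · intro i _
    rw [coeff_pSym, if_pos ((exponents_eq_singleton_iff k.ne_zero _).2 ⟨i, rfl⟩), one_mul]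

/-- Newton's identities for weighted sums of monomials. -/
theorem natCast_mul_weightedHSym {c r : ℕ → R} (hc : c 0 = 1)
    (hr : ∀ a : ℕ, (a : R) * c a = ∑ k ∈ Finset.range a, r (k + 1) * c (a - (k + 1))) (n : ℕ) :
    (n : R) • weightedHSym c n =
      ∑ k ∈ Finset.range n, r (k + 1) • (pSym R k.succPNat * weightedHSym c (n - (k + 1))) := by
  classical
  apply Subtype.ext
  refine MvPowerSeries.ext fun m => ?_
  rw [AddSubmonoidClass.coe_finsetSum, map_sum]
  simp only [SetLike.val_smul, MulMemClass.coe_mul, map_smul, smul_eq_mul, coeff_pSym_mul,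
    Nat.succPNat_coe, Nat.succ_eq_add_one]
  have hsub (i k : ℕ) : (m - Finsupp.single i k).support ⊆ m.support := Finsupp.support_tsub
  simp_rw [coeff_weightedHSym hc _ (hsub _ _)]
  rw [coeff_weightedHSym hc _ subset_rfl]
  have hdeg (i k : ℕ) (h : k ≤ m i) : (m - Finsupp.single i k).degree + k = m.degree := by
    have := congrArg Finsupp.degree (tsub_add_cancel_of_le (Finsupp.single_le_iff.2 h))
    rwa [map_add, Finsupp.degree_single] at this
  by_cases hm : m.degree = n
  · have hd : (n : R) = ∑ i ∈ m.support, (m i : R) := by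
      rw [← hm, Finsupp.degree_apply, Nat.cast_sum]
    rw [if_pos hm, hd, Finset.sum_mul]
    simp_rw [Finset.mul_sum]
    rw [Finset.sum_comm]
    refine Finset.sum_congr rfl fun i hi => ?_
    rw [← Finset.mul_prod_erase _ _ hi, ← mul_assoc, hr, Finset.sum_mul]
    have hle : m i ≤ n := hm ▸ Finsupp.le_degree i m
    refine Finset.sum_subset_zero_on_sdiff (Finset.range_subset_range.2 hle) ?_ ?_
    · intro k hk
      have : ¬ k + 1 ≤ m i := by simp at hk; omega
      rw [if_neg this, mul_zero]
    · intro k hk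
      have hk' : k + 1 ≤ m i := by simp at hk; omega
      have h1 := hdeg i (k + 1) hk'
      rw [if_pos hk', if_pos (by omega),
        ← Finset.mul_prod_erase _ _ hi, mul_assoc]
      congr 2
      · simp
      · refine Finset.prod_congr rfl fun j hj => ?_
        have : i ≠ j := (Finset.ne_of_mem_erase hj).symm
        simp [this]
  · rw [if_neg hm, mul_zero]
    symm
    refine Finset.sum_eq_zero fun k hk => ?_
    rw [Finset.sum_eq_zero, mul_zero]
    intro i _
    split_ifs with h1 h2
    · have := hdeg i (k + 1) h1
      simp at hk
      omega
    · rfl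
    · rfl

end

/-- The plethysm `h_n[x]` for an element `x` with `p_k(x) = r_k p_k`. -/
theorem plethysm_hSym {R : Type*} [CommRing R] [Algebra ℚ R] [LambdaRing R] {c r : ℕ → R}
    (hc : c 0 = 1) (hr : ∀ a : ℕ, (a : R) * c a = ∑ k ∈ Finset.range a, r (k + 1) * c (a - (k + 1)))
    {x : SymFun R} (hx : ∀ k : ℕ+, LambdaRing.adams k x = r k • pSym R k) (n : ℕ) :
    plethysm (hSym ℚ n) x = weightedHSym c n := by
  have key : ∃ f : MvPolynomial ℕ+ ℚ, MvPolynomial.aeval (pSym ℚ) f = hSym ℚ n ∧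
      MvPolynomial.aeval (fun k => LambdaRing.adams k x) f = weightedHSym c n := by
    induction n using Nat.strong_induction_on with
    | _ n ih =>
      rcases Nat.eq_zero_or_pos n with rfl | hn
      · exact ⟨1, by rw [map_one, ← weightedHSym_one, weightedHSym_zero rfl],
          by rw [map_one, weightedHSym_zero hc]⟩
      choose! f hf using ih
      have hn0 : (n : ℚ) ≠ 0 := by positivity
      refine ⟨(n : ℚ)⁻¹ • ∑ k ∈ Finset.range n, MvPolynomial.X k.succPNat * f (n - (k + 1)), ?_, ?_⟩
      · rw [map_smul, inv_smul_eq_iff₀ hn0, ← weightedHSym_one,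
          natCast_mul_weightedHSym (r := fun _ => 1) rfl (by simp), map_sum]
        refine Finset.sum_congr rfl fun k hk => ?_
        rw [one_smul, map_mul, MvPolynomial.aeval_X, (hf _ (by simp at hk; omega)).1,
          weightedHSym_one]
      · have h := natCast_mul_weightedHSym hc hr n
        rw [map_smul, inv_smul_eq_iff₀ hn0]
        have h2 : (n : ℚ) • weightedHSym c n = (n : R) • weightedHSym c n := by
          rw [Nat.cast_smul_eq_nsmul, Nat.cast_smul_eq_nsmul]
        rw [h2, h, map_sum]
        refine Finset.sum_congr rfl fun k hk => ?_
        rw [map_mul, MvPolynomial.aeval_X, (hf _ (by simp at hk; omega)).2, hx, smul_mul_assoc]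
        rfl
  obtain ⟨f, hf, hf'⟩ := key
  have hex : ∃ f : MvPolynomial ℕ+ ℚ, MvPolynomial.aeval (pSym ℚ) f = hSym ℚ n := ⟨f, hf⟩
  rw [plethysm, dif_pos hex, ← hf']
  congr 1
  exact algebraicIndependent_pSym (hex.choose_spec.trans hf.symm)

/-- `h_n[x]` expanded in monomial symmetric functions. -/
theorem weightedHSym_eq_sum_mSym {R : Type*} [CommRing R] (c : ℕ → R) (n : ℕ) :
    weightedHSym c n = ∑ ν : n.Partition, (ν.parts.map c).prod • mSym R ν := by
  classical
  apply Subtype.ext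
  refine MvPowerSeries.ext fun m => ?_
  rw [AddSubmonoidClass.coe_finsetSum, map_sum]
  have h (ν : n.Partition) : MvPowerSeries.coeff m
      (((ν.parts.map c).prod • mSym R ν : SymFun R) : MvPowerSeries ℕ R) =
      if exponents m = ν.parts then (ν.parts.map c).prod else 0 := by
    rw [← mul_one (ν.parts.map c).prod, ← mul_ite_zero, mul_one]
    rfl
  simp_rw [h]
  change (if (exponents m).sum = n then ((exponents m).map c).prod else 0) = _
  split_ifs with hm
  · have hpos : ∀ {i}, i ∈ exponents m → 0 < i := by
      intro i hi
      obtain ⟨j, hj, rfl⟩ := Multiset.mem_map.1 hi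
      exact Nat.pos_of_ne_zero (Finsupp.mem_support_iff.1 hj)
    rw [Finset.sum_eq_single_of_mem ⟨exponents m, hpos, hm⟩ (Finset.mem_univ _), if_pos rfl]
    intro ν _ hν
    rw [if_neg]
    intro h
    exact hν (Nat.Partition.ext h.symm)
  · symm
    refine Finset.sum_eq_zero fun ν _ => if_neg ?_
    intro h
    exact hm (by rw [h, ν.parts_sum])

/-- The logarithmic derivative of `∏_{i ≥ 1} (1 - t q ^ (-i))⁻¹`, compared coefficientwise. -/
theorem natCast_mul_eq_sum_of_recurrence {K : Type*} [Field K] {q : K} {c : ℕ → K}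
    (hq : ∀ k : ℕ, q ^ (k + 1) ≠ 1)
    (hc : ∀ a, c (a + 1) * (q ^ (a + 1) - 1) = q ^ a * c a) (a : ℕ) :
    (a : K) * c a = ∑ k ∈ Finset.range a, (q ^ (k + 1) - 1)⁻¹ * c (a - (k + 1)) := by
  set r : ℕ → K := fun k => (q ^ (k + 1) - 1)⁻¹ with hr
  have hrq (k : ℕ) : r k * q ^ (k + 1) = r k + 1 := by
    have : q ^ (k + 1) - 1 ≠ 0 := sub_ne_zero.2 (hq k)
    rw [hr]
    field_simp
    ring
  induction a with
  | zero => simp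
  | succ a ih =>
    have hne : q ^ (a + 1) - 1 ≠ 0 := sub_ne_zero.2 (hq a)
    apply mul_right_cancel₀ hne
    have h1 : (∑ k ∈ Finset.range (a + 1), r k * c (a + 1 - (k + 1))) * q ^ (a + 1) =
        ∑ k ∈ Finset.range (a + 1), r k * (c (a - k) * q ^ (a - k)) +
          ∑ k ∈ Finset.range (a + 1), c (a - k) * q ^ (a - k) := by
      rw [Finset.sum_mul, ← Finset.sum_add_distrib]
      refine Finset.sum_congr rfl fun k hk => ?_
      have hk' : k ≤ a := Nat.lt_succ_iff.1 (Finset.mem_range.1 hk)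
      have h2 : q ^ (a + 1) = q ^ (k + 1) * q ^ (a - k) := by
        rw [← pow_add]
        congr 1
        omega
      rw [Nat.add_sub_add_right, h2]
      linear_combination c (a - k) * q ^ (a - k) * hrq k
    have h3 : ∑ k ∈ Finset.range (a + 1), r k * (c (a - k) * q ^ (a - k)) =
        ∑ k ∈ Finset.range (a + 1), r k * c (a + 1 - (k + 1)) +
          (q ^ a * (∑ k ∈ Finset.range a, r k * c (a - (k + 1))) -
            ∑ k ∈ Finset.range a, c (a - (k + 1)) * q ^ (a - (k + 1))) := by
      rw [Finset.sum_range_succ, Finset.sum_range_succ _ a, Finset.mul_sum,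
        ← Finset.sum_sub_distrib, add_right_comm, ← Finset.sum_add_distrib]
      simp only [Nat.add_sub_add_right, Nat.sub_self, pow_zero, mul_one]
      congr 1
      refine Finset.sum_congr rfl fun k hk => ?_
      have hk' : k < a := Finset.mem_range.1 hk
      obtain ⟨b, rfl⟩ := Nat.exists_eq_add_of_lt hk'
      have e1 : k + b + 1 - k = b + 1 := by omega
      have e2 : k + b + 1 - (k + 1) = b := by omega
      have e3 : q ^ (k + b + 1) = q ^ (k + 1) * q ^ b := by rw [← pow_add]; congr 1; omega
      rw [e1, e2, e3]
      linear_combination r k * hc b - q ^ b * c b * hrq k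
    have h4 : ∑ k ∈ Finset.range (a + 1), c (a - k) * q ^ (a - k) =
        c a * q ^ a + ∑ k ∈ Finset.range a, c (a - (k + 1)) * q ^ (a - (k + 1)) := by
      rw [Finset.sum_range_succ', add_comm, Nat.sub_zero]
    rw [mul_sub_one (∑ k ∈ Finset.range (a + 1), _), h1, h3, h4, ← ih]
    push_cast
    linear_combination ((a : K) + 1) * hc a

/-- The polynomial `∏_{i = 1}^n (q ^ i - 1)`. -/
noncomputable def qFactorial (n : ℕ) : ℤ[X] := ∏ i ∈ Finset.range n, (X ^ (i + 1) - 1)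

theorem qFactorial_succ (n : ℕ) : qFactorial (n + 1) = qFactorial n * (X ^ (n + 1) - 1) :=
  Finset.prod_range_succ _ _

theorem qFactorial_mul_dvd (a b : ℕ) : qFactorial a * qFactorial b ∣ qFactorial (a + b) := by
  induction h : a + b generalizing a b with
  | zero =>
    obtain ⟨rfl, rfl⟩ : a = 0 ∧ b = 0 := by omega
    simp [qFactorial]
  | succ n ih =>
    rcases a with - | a
    · obtain rfl : b = n + 1 := by omega
      simp [qFactorial]
    rcases b with - | b
    · obtain rfl : a = n := by omega
      simp [qFactorial]
    have h1 := ih a (b + 1) (by omega)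
    have h2 := ih (a + 1) b (by omega)
    have hX : (X ^ (n + 1) - 1 : ℤ[X]) = X ^ (b + 1) * (X ^ (a + 1) - 1) + (X ^ (b + 1) - 1) := by
      rw [← h]
      ring
    rw [qFactorial_succ n, hX, mul_add]
    refine dvd_add ?_ ?_
    · rw [qFactorial_succ a]
      exact Dvd.dvd.trans ⟨X ^ (b + 1), by ring⟩
        (mul_dvd_mul_right h1 (X ^ (b + 1) * (X ^ (a + 1) - 1)))
    · rw [qFactorial_succ b, ← mul_assoc]
      exact mul_dvd_mul_right h2 (X ^ (b + 1) - 1)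

theorem prod_qFactorial_dvd (s : Multiset ℕ) : (s.map qFactorial).prod ∣ qFactorial s.sum := by
  induction s using Multiset.induction_on with
  | empty => simp [qFactorial]
  | cons a s ih =>
    rw [Multiset.map_cons, Multiset.prod_cons, Multiset.sum_cons]
    exact (mul_dvd_mul_left _ ih).trans (qFactorial_mul_dvd _ _)

/-- The number of elements of `GL_n(𝔽_q)` as a polynomial in `q`. -/
noncomputable def glPoly (n : ℕ) : ℤ[X] := X ^ (n.choose 2) * qFactorial n

theorem glPoly_eq_prod (n : ℕ) : glPoly n = ∏ i ∈ Finset.range n, (X ^ n - X ^ i) := by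
  rw [glPoly, qFactorial, Nat.choose_two_right, ← Finset.sum_range_id, ← Finset.prod_pow_eq_pow_sum,
    ← Finset.prod_range_reflect (fun i => (X ^ (i + 1) - 1 : ℤ[X])), ← Finset.prod_mul_distrib]
  refine Finset.prod_congr rfl fun i hi => ?_
  have hi' : i < n := Finset.mem_range.1 hi
  rw [mul_sub_one, ← pow_add]
  congr 2
  omega

/-- The multinomial quotient `∏_{i ≤ n} (q ^ i - 1) / ∏_j ∏_{i ≤ ν_j} (q ^ i - 1)`. -/
noncomputable def qMultinomial {n : ℕ} (ν : n.Partition) : ℤ[X] :=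
  (prod_qFactorial_dvd ν.parts).choose

theorem qMultinomial_spec {n : ℕ} (ν : n.Partition) :
    qFactorial n = (ν.parts.map qFactorial).prod * qMultinomial ν := by
  exact (congrArg qFactorial ν.parts_sum).symm.trans (prod_qFactorial_dvd ν.parts).choose_spec

/-- The coefficient of `m_ν` in `|GL_n| h_n[X / (q - 1)]`. -/
noncomputable def springerPoly {n : ℕ} (ν : n.Partition) : ℤ[X] :=
  X ^ (n.choose 2 + (ν.parts.map fun a => a.choose 2).sum) * qMultinomial ν

theorem prod_map_X_pow {R : Type*} [CommMonoid R] (x : R) (f : ℕ → ℕ) (s : Multiset ℕ) :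
    (s.map fun a => x ^ f a).prod = x ^ (s.map f).sum := by
  induction s using Multiset.induction_on with
  | empty => simp
  | cons a s ih => simp [ih, pow_add]

theorem springerPoly_mul_prod_glPoly {n : ℕ} (ν : n.Partition) :
    springerPoly ν * (ν.parts.map glPoly).prod =
      glPoly n * (ν.parts.map fun a => (X : ℤ[X]) ^ (a * a - a)).prod := by
  have h1 : (ν.parts.map glPoly).prod =
      X ^ (ν.parts.map fun a => a.choose 2).sum * (ν.parts.map qFactorial).prod := by
    rw [← prod_map_X_pow, ← Multiset.prod_map_mul]
    rfl
  have h2 (a : ℕ) : a * a - a = a.choose 2 + a.choose 2 := by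
    rw [← two_mul, Nat.choose_two_right, Nat.mul_div_cancel' (Nat.even_mul_pred_self a).two_dvd,
      Nat.mul_sub_one]
  simp_rw [h1, h2, prod_map_X_pow, Multiset.sum_map_add, springerPoly, glPoly, qMultinomial_spec ν]
  ring

/-- `toRatFunc` as a ring homomorphism. -/
noncomputable def toRatFuncHom : ℤ[X] →+* RatFunc ℚ :=
  (algebraMap ℚ[X] (RatFunc ℚ)).comp (Polynomial.mapRingHom (Int.castRingHom ℚ))

theorem toRatFuncHom_apply (f : ℤ[X]) : toRatFuncHom f = toRatFunc f := rfl

theorem toRatFuncHom_X : toRatFuncHom X = RatFunc.X := by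
  simp [toRatFuncHom]

theorem toRatFuncHom_injective : Function.Injective toRatFuncHom :=
  (RatFunc.algebraMap_injective ℚ).comp
    (Polynomial.map_injective _ (RingHom.injective_int _))

theorem X_pow_sub_one_ne_zero_int (k : ℕ) : (X ^ (k + 1) - 1 : ℤ[X]) ≠ 0 :=
  (monic_X_pow_sub_C (1 : ℤ) k.succ_ne_zero).ne_zero

theorem qFactorial_ne_zero (n : ℕ) : qFactorial n ≠ 0 :=
  Finset.prod_ne_zero_iff.2 fun i _ => X_pow_sub_one_ne_zero_int i

theorem glPoly_ne_zero (n : ℕ) : glPoly n ≠ 0 :=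
  mul_ne_zero (pow_ne_zero _ X_ne_zero) (qFactorial_ne_zero n)

theorem ratFuncX_pow_ne_one (k : ℕ) : (RatFunc.X : RatFunc ℚ) ^ (k + 1) ≠ 1 := by
  intro h
  apply X_pow_sub_one_ne_zero_int k
  apply toRatFuncHom_injective
  rw [map_sub, map_pow, toRatFuncHom_X, h, map_one, sub_self, map_zero]

theorem adams_pSym_one {R : Type*} [CommRing R] [Algebra ℚ R] [LambdaRing R] (k : ℕ+) :
    LambdaRing.adams k (pSym R 1) = pSym R k := by
  apply Subtype.ext
  refine MvPowerSeries.ext fun m => ?_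
  change MvPowerSeries.coeff m (MvPowerSeries.expand (k : ℕ) k.ne_zero
    (MvPowerSeries.map (LambdaRing.adams k) (pSym R 1 : MvPowerSeries ℕ R))) = _
  rw [coeff_pSym]
  by_cases h : ∀ i, (k : ℕ) ∣ m i
  · obtain ⟨l, rfl⟩ : ∃ l : ℕ →₀ ℕ, (k : ℕ) • l = m :=
      ⟨m.mapRange (fun a => a / k) (by simp), by
        ext i; simp [Nat.mul_div_cancel' (h i)]⟩
    rw [MvPowerSeries.coeff_expand_smul, MvPowerSeries.coeff_map, coeff_pSym,
      MonoidWithZeroHom.map_ite_one_zero]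
    refine if_congr ?_ rfl rfl
    rw [exponents_eq_singleton_iff k.ne_zero, exponents_eq_singleton_iff (1 : ℕ+).ne_zero]
    refine exists_congr fun i => ?_
    have : Finsupp.single i (k : ℕ) = (k : ℕ) • Finsupp.single i ((1 : ℕ+) : ℕ) := by simp
    rw [this, smul_right_inj k.ne_zero]
  · push Not at h
    obtain ⟨i, hi⟩ := h
    rw [MvPowerSeries.coeff_expand_of_not_dvd _ _ _ hi, if_neg]
    intro he
    obtain ⟨j, rfl⟩ := (exponents_eq_singleton_iff k.ne_zero m).1 he
    apply hi
    rw [Finsupp.single_apply]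
    split_ifs <;> simp

/-- The expansion of `h_n[X / (q - 1)]` in monomial symmetric functions. -/
theorem plethysm_hSym_div (n : ℕ) :
    plethysm (hSym ℚ n) ((RatFunc.X - 1 : RatFunc ℚ)⁻¹ • pSym (RatFunc ℚ) 1) =
      (toRatFunc (glPoly n))⁻¹ •
        ∑ ν : n.Partition, toRatFunc (springerPoly ν) • mSym (RatFunc ℚ) ν := by
  set c : ℕ → RatFunc ℚ := fun a => RatFunc.X ^ (a * a - a) / toRatFuncHom (glPoly a) with hc
  have hq := ratFuncX_pow_ne_one
  have hX : (RatFunc.X : RatFunc ℚ) ≠ 0 := RatFunc.X_ne_zero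
  have hgl (n : ℕ) : toRatFuncHom (glPoly n) ≠ 0 :=
    (map_ne_zero_iff _ toRatFuncHom_injective).2 (glPoly_ne_zero n)
  have hc0 : c 0 = 1 := by simp [hc, glPoly, qFactorial]
  have hrec (a : ℕ) : c (a + 1) * (RatFunc.X ^ (a + 1) - 1) = RatFunc.X ^ a * c a := by
    have h1 : toRatFuncHom (glPoly (a + 1)) =
        RatFunc.X ^ a * (toRatFuncHom (glPoly a) * (RatFunc.X ^ (a + 1) - 1)) := by
      rw [glPoly, glPoly, qFactorial_succ, Nat.choose_succ_succ' a 1, Nat.choose_one_right, pow_add]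
      simp only [map_mul, map_pow, map_sub, map_one, toRatFuncHom_X]
      ring
    have h2 : (a + 1) * (a + 1) - (a + 1) = a + (a + (a * a - a)) := by
      have : a ≤ a * a := Nat.le_mul_self a
      have : (a + 1) * (a + 1) = a * a + 2 * a + 1 := by ring
      omega
    have h3 : RatFunc.X ^ (a + 1) - 1 ≠ (0 : RatFunc ℚ) := sub_ne_zero.2 (hq a)
    have h4 := hgl a
    simp only [hc]
    rw [h1, h2, pow_add, pow_add]
    field_simp
  rw [plethysm_hSym (c := c) (r := fun k => (RatFunc.X ^ k - 1)⁻¹) hc0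
    (natCast_mul_eq_sum_of_recurrence hq hrec), weightedHSym_eq_sum_mSym, Finset.smul_sum]
  · refine Finset.sum_congr rfl fun ν _ => ?_
    rw [smul_smul]
    congr 1
    have h1 := congrArg toRatFuncHom (springerPoly_mul_prod_glPoly ν)
    simp only [map_mul, map_multiset_prod, Multiset.map_map, Function.comp_def, map_pow,
      toRatFuncHom_X] at h1
    have h2 : (ν.parts.map fun a => toRatFuncHom (glPoly a)).prod ≠ 0 :=
      Multiset.prod_ne_zero fun h => by
        obtain ⟨a, _, ha⟩ := Multiset.mem_map.1 h
        exact hgl a ha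
    rw [← toRatFuncHom_apply, ← toRatFuncHom_apply, hc, Multiset.prod_map_div, inv_mul_eq_div,
      div_eq_div_iff h2 (hgl n), mul_comm, ← h1]
  · intro k
    rw [Algebra.smul_def, map_mul, adams_algebraMap, adams_pSym_one, Algebra.smul_def]
    congr 2
    change ratFuncAdams k _ = _
    have h1 : ratFuncAdams k RatFunc.X = RatFunc.X ^ (k : ℕ) := by
      have := ratFuncAdams_div k X 1
      simpa using this
    rw [map_inv₀, map_sub, map_one, h1]

/-- Orbit counting for a set `D` that meets every orbit of the saturated set in one orbit of `H`. -/
theorem card_saturation_mul_card {G X : Type*} [Group G] (act : G → X → X)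
    (act_one : ∀ x, act 1 x = x) (act_mul : ∀ g h x, act (g * h) x = act g (act h x))
    (H : Subgroup G) (D : Set X) (hD : ∀ h ∈ H, ∀ d ∈ D, act h d ∈ D)
    (hH : ∀ g, ∀ d ∈ D, act g d ∈ D → g ∈ H) :
    Nat.card {x | ∃ g, ∃ d ∈ D, act g d = x} * Nat.card H = Nat.card G * Nat.card D := by
  rw [← Nat.card_prod, ← Nat.card_prod]
  have act_inv (g : G) (x : X) : act g⁻¹ (act g x) = x := by rw [← act_mul, inv_mul_cancel, act_one]
  choose γ hγ using fun x : {x | ∃ g, ∃ d ∈ D, act g d = x} => x.2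
  choose δ hδ hγδ using hγ
  symm
  refine Nat.card_congr
    { toFun := fun p => (⟨act p.1 p.2, p.1, p.2, p.2.2, rfl⟩,
        ⟨(γ ⟨act p.1 p.2, p.1, p.2, p.2.2, rfl⟩)⁻¹ * p.1, hH _ p.2 p.2.2 ?_⟩)
      invFun := fun p => (γ p.1 * p.2, ⟨act (p.2 : G)⁻¹ (δ p.1), hD _ (H.inv_mem p.2.2) _ (hδ _)⟩)
      left_inv := ?_
      right_inv := ?_ }
  · rw [act_mul]
    generalize_proofs hx
    have h := congrArg (act (γ ⟨act p.1 p.2, hx⟩)⁻¹) (hγδ ⟨act p.1 p.2, hx⟩)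
    rw [act_inv] at h
    exact h ▸ hδ _
  · rintro ⟨g, d, hd⟩
    ext
    · simp
    · simp only [mul_inv_rev, inv_inv, act_mul]
      rw [hγδ, act_inv]
  · rintro ⟨x, h, hh⟩
    have hx : act (γ x * h) (act h⁻¹ (δ x)) = x := by
      rw [act_mul, ← act_mul h, mul_inv_cancel, act_one, hγδ]
    refine Prod.ext (Subtype.ext hx) (Subtype.ext ?_)
    simp [hx]

namespace Matrix

variable {F : Type*} [Field F] {ι κ : Type*} [Fintype ι] [DecidableEq ι] [Fintype κ] [DecidableEq κ]

theorem isNilpotent_iff_charpoly_eq (M : Matrix ι ι F) :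
    IsNilpotent M ↔ M.charpoly = X ^ Fintype.card ι := by
  constructor
  · intro h
    exact sub_eq_zero.1 (isNilpotent_charpoly_sub_pow_of_isNilpotent h).eq_zero
  · intro h
    refine ⟨Fintype.card ι, ?_⟩
    have := M.aeval_self_charpoly
    rwa [h, map_pow, aeval_X] at this

theorem natTrailingDegree_charpoly_fromBlocks {N : Matrix ι ι F} {A : Matrix κ κ F}
    (hN : IsNilpotent N) (hA : IsUnit A) :
    (fromBlocks N 0 0 A).charpoly.natTrailingDegree = Fintype.card ι := by
  have h1 : A.charpoly.natTrailingDegree = 0 := by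
    refine natTrailingDegree_eq_zero_of_constantCoeff_ne_zero ?_
    rw [constantCoeff_apply]
    intro h
    rw [isUnit_iff_isUnit_det, det_eq_sign_charpoly_coeff, h, mul_zero] at hA
    exact not_isUnit_zero hA
  rw [charpoly_fromBlocks_zero₁₂, natTrailingDegree_mul (charpoly_monic _).ne_zero
    (charpoly_monic _).ne_zero, h1, (isNilpotent_iff_charpoly_eq N).1 hN, natTrailingDegree_X_pow,
    add_zero]

theorem charpoly_units_conj_inv (g : GL ι F) (M : Matrix ι ι F) :
    ((g : Matrix ι ι F) * M * (g⁻¹ : GL ι F)).charpoly = M.charpoly := by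
  rw [coe_units_inv]
  exact charpoly_units_conj g M

/-- The Fitting decomposition of a square matrix. -/
theorem exists_eq_conj_fromBlocks (T : Matrix (ι ⊕ κ) (ι ⊕ κ) F)
    (hT : T.charpoly.natTrailingDegree = Fintype.card ι) :
    ∃ (g : GL (ι ⊕ κ) F) (N : Matrix ι ι F) (A : Matrix κ κ F), IsNilpotent N ∧ IsUnit A ∧
      (g : Matrix (ι ⊕ κ) (ι ⊕ κ) F) * fromBlocks N 0 0 A * (g⁻¹ : GL (ι ⊕ κ) F) = T := by
  set φ : Module.End F (ι ⊕ κ → F) := toLin' T with hφ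
  set V := φ.maxGenEigenspace 0 with hVdef
  have hV : V = ⨆ (n : ℕ), LinearMap.ker (φ ^ n) := by
    simp [V, ← Module.End.iSup_genEigenspace_eq, Module.End.genEigenspace_nat]
  let W := ⨅ (n : ℕ), LinearMap.range (φ ^ n)
  have hVW : IsCompl V W := by
    rw [hV]
    exact LinearMap.isCompl_iSup_ker_pow_iInf_range_pow φ
  have hmemV (x) : x ∈ V ↔ ∃ n : ℕ, (φ ^ n) x = 0 := by
    simp only [V, Module.End.mem_maxGenEigenspace, zero_smul, sub_zero]
  have hφV : ∀ x ∈ V, φ x ∈ V := by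
    intro x hx
    obtain ⟨n, hx⟩ := (hmemV x).1 hx
    refine (hmemV _).2 ⟨n, ?_⟩
    rw [← Module.End.mul_apply, ← pow_succ, pow_succ', Module.End.mul_apply, hx, map_zero]
  have hφW : ∀ x ∈ W, φ x ∈ W := by
    simp only [W, Submodule.mem_iInf, LinearMap.mem_range]
    intro x H n
    obtain ⟨y, rfl⟩ := H n
    use φ y
    rw [← Module.End.mul_apply, ← pow_succ, pow_succ', Module.End.mul_apply]
  set f := φ.restrict hφV with hf
  set h := φ.restrict hφW with hh
  let e := Submodule.prodEquivOfIsCompl V W hVW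
  have hdV : Module.finrank F V = Fintype.card ι := by
    rw [hVdef, LinearMap.finrank_maxGenEigenspace_zero_eq, ← hT, hφ, charpoly_toLin']
  have hdW : Module.finrank F W = Fintype.card κ := by
    have := Submodule.finrank_add_eq_of_isCompl hVW
    rw [hdV, Module.finrank_fintype_fun_eq_card, Fintype.card_sum] at this
    omega
  let bV : Module.Basis ι F V := 
    (Module.finBasisOfFinrankEq F V hdV).reindex (Fintype.equivFin ι).symm
  let bW : Module.Basis κ F W :=
    (Module.finBasisOfFinrankEq F W hdW).reindex (Fintype.equivFin κ).symm
  let b : Module.Basis (ι ⊕ κ) F (ι ⊕ κ → F) := (bV.prod bW).map e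
  have hmat : LinearMap.toMatrix b b φ =
      fromBlocks (LinearMap.toMatrix bV bV f) 0 0 (LinearMap.toMatrix bW bW h) := by
    have hψ : f.prodMap h = e.symm.conj φ := by
      apply (bV.prod bW).ext
      simp only [Module.Basis.prod_apply, LinearMap.coe_inl, LinearMap.coe_inr,
        LinearMap.prodMap_apply, LinearEquiv.conj_apply, LinearEquiv.symm_symm,
        Submodule.coe_prodEquivOfIsCompl, LinearMap.coe_comp, LinearEquiv.coe_coe,
        Function.comp_apply, LinearMap.coprod_apply, Submodule.coe_subtype, map_add, Sum.forall,
        Sum.elim_inl, map_zero, ZeroMemClass.coe_zero, add_zero, LinearEquiv.eq_symm_apply,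
        and_self, Submodule.coe_prodEquivOfIsCompl', LinearMap.coe_restrict_apply, implies_true,
        Sum.elim_inr, zero_add, e, V, W, f, h]
    rw [← LinearMap.toMatrix_prodMap, hψ]
    ext i j
    simp [b, LinearMap.toMatrix_apply]
  have hker : LinearMap.ker h = ⊥ := by
    rw [LinearMap.ker_eq_bot']
    intro x hx
    apply Subtype.ext
    have : x.1 ∈ V ⊓ W := ⟨(hmemV _).2 ⟨1, by rw [pow_one]; exact congrArg Subtype.val hx⟩, x.2⟩
    rwa [hVW.inf_eq_bot, Submodule.mem_bot] at this
  have hnil : IsNilpotent f := by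
    refine ((LinearMap.charpoly_nilpotent_tfae f).out 0 2).2 fun x => ?_
    obtain ⟨n, hn⟩ := (hmemV _).1 x.2
    refine ⟨n, Subtype.ext ?_⟩
    rw [hf, Module.End.pow_restrict]
    exact hn
  let P := b.toMatrix (Pi.basisFun F (ι ⊕ κ))
  let Q := (Pi.basisFun F (ι ⊕ κ)).toMatrix b
  refine ⟨⟨Q, P, ?_, ?_⟩, LinearMap.toMatrix bV bV f, LinearMap.toMatrix bW bW h, ?_, ?_, ?_⟩
  · exact Module.Basis.toMatrix_mul_toMatrix_flip _ _
  · exact Module.Basis.toMatrix_mul_toMatrix_flip _ _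
  · exact hnil.map (LinearMap.toMatrixAlgEquiv bV)
  · have hu : IsUnit h := (LinearMap.isUnit_iff_ker_eq_bot h).2 hker
    exact hu.map (LinearMap.toMatrixAlgEquiv bW)
  · rw [← hmat]
    change Q * _ * P = T
    rw [basis_toMatrix_mul_linearMap_toMatrix_mul_basis_toMatrix, hφ]
    simp

end Matrix

namespace Matrix

variable {F : Type*} [Field F] {ι κ : Type*} [Fintype ι] [DecidableEq ι] [Fintype κ] [DecidableEq κ]

/-- Block diagonal matrices with two blocks. -/
def fromBlocksHom (F ι κ : Type*) [Field F] [Fintype ι] [DecidableEq ι] [Fintype κ]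
    [DecidableEq κ] : Matrix ι ι F × Matrix κ κ F →* Matrix (ι ⊕ κ) (ι ⊕ κ) F where
  toFun p := fromBlocks p.1 0 0 p.2
  map_one' := fromBlocks_one
  map_mul' p q := by simp [fromBlocks_multiply]

theorem fromBlocksHom_injective : Function.Injective (fromBlocksHom F ι κ) := by
  intro p q h
  obtain ⟨h1, _, _, h2⟩ := fromBlocks_inj.1 h
  exact Prod.ext h1 h2

theorem pow_mul_eq_mul_pow {R m n : Type*} [CommRing R] [Fintype m] [DecidableEq m] [Fintype n]
    [DecidableEq n] {A : Matrix m m R} {B : Matrix n n R} {C : Matrix m n R}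
    (h : A * C = C * B) (j : ℕ) : A ^ j * C = C * B ^ j := by
  induction j with
  | zero => simp
  | succ j ih => rw [pow_succ, Matrix.mul_assoc, h, ← Matrix.mul_assoc, ih, Matrix.mul_assoc,
      ← pow_succ]

theorem eq_zero_of_isNilpotent_mul_eq_mul_isUnit {A : Matrix ι ι F} {B : Matrix κ κ F}
    {C : Matrix ι κ F} (hA : IsNilpotent A) (hB : IsUnit B) (h : A * C = C * B) : C = 0 := by
  obtain ⟨j, hj⟩ := hA
  have h1 := pow_mul_eq_mul_pow h j
  obtain ⟨u, hu⟩ := hB.pow j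
  rw [hj, Matrix.zero_mul, ← hu] at h1
  have : C * (u : Matrix κ κ F) * u⁻¹.val = 0 := by rw [← h1, Matrix.zero_mul]
  rwa [Matrix.mul_assoc, u.mul_inv, Matrix.mul_one] at this

theorem eq_zero_of_isUnit_mul_eq_mul_isNilpotent {A : Matrix ι ι F} {B : Matrix κ κ F}
    {C : Matrix ι κ F} (hA : IsUnit A) (hB : IsNilpotent B) (h : A * C = C * B) : C = 0 := by
  obtain ⟨j, hj⟩ := hB
  have h1 := pow_mul_eq_mul_pow h j
  obtain ⟨u, hu⟩ := hA.pow j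
  rw [hj, Matrix.mul_zero, ← hu] at h1
  have : u⁻¹.val * ((u : Matrix ι ι F) * C) = 0 := by rw [h1, Matrix.mul_zero]
  rwa [← Matrix.mul_assoc, u.inv_mul, Matrix.one_mul] at this

theorem setOf_natTrailingDegree_charpoly_eq :
    {T : Matrix (ι ⊕ κ) (ι ⊕ κ) F | T.charpoly.natTrailingDegree = Fintype.card ι} =
      {T | ∃ g : GL (ι ⊕ κ) F, ∃ d ∈ fromBlocksHom F ι κ '' {p | IsNilpotent p.1 ∧ IsUnit p.2},
        (g : Matrix (ι ⊕ κ) (ι ⊕ κ) F) * d * (g⁻¹ : GL (ι ⊕ κ) F) = T} := by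
  ext T
  constructor
  · intro hT
    obtain ⟨g, N, A, hN, hA, h⟩ := exists_eq_conj_fromBlocks T hT
    exact ⟨g, _, ⟨(N, A), ⟨hN, hA⟩, rfl⟩, h⟩
  · rintro ⟨g, _, ⟨⟨N, A⟩, ⟨hN, hA⟩, rfl⟩, rfl⟩
    rw [Set.mem_ofPred_eq, charpoly_units_conj_inv]
    exact natTrailingDegree_charpoly_fromBlocks hN hA

theorem card_natTrailingDegree_charpoly_eq [Finite F] :
    Nat.card {T : Matrix (ι ⊕ κ) (ι ⊕ κ) F | T.charpoly.natTrailingDegree = Fintype.card ι} *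
      (Nat.card (GL ι F) * Nat.card (GL κ F)) =
    Nat.card (GL (ι ⊕ κ) F) *
      (Nat.card {N : Matrix ι ι F | IsNilpotent N} * Nat.card (GL κ F)) := by
  have key := card_saturation_mul_card
    (fun (g : GL (ι ⊕ κ) F) (T : Matrix (ι ⊕ κ) (ι ⊕ κ) F) => g.val * T * g⁻¹.val)
    (by simp) (by intros; simp [Matrix.mul_assoc])
    (Units.map (fromBlocksHom F ι κ)).range
    (fromBlocksHom F ι κ '' {p | IsNilpotent p.1 ∧ IsUnit p.2}) ?_ ?_
  · rw [setOf_natTrailingDegree_charpoly_eq]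
    convert key using 2
    · rw [← Nat.card_prod, ← Nat.card_congr
        (MonoidHom.ofInjective (Units.map_injective fromBlocksHom_injective)).toEquiv]
      exact Nat.card_congr MulEquiv.prodUnits.symm.toEquiv
    · rw [Nat.card_image_of_injective fromBlocksHom_injective, ← Nat.card_prod]
      refine Nat.card_congr
        { toFun := fun p => ⟨(p.1, p.2), p.1.2, p.2.isUnit⟩
          invFun := fun p => (⟨p.1.1, p.2.1⟩, p.2.2.unit)
          left_inv := fun p => by ext <;> simp
          right_inv := fun p => by simp }
  · rintro _ ⟨u, rfl⟩ _ ⟨⟨N, A⟩, ⟨hN, hA⟩, rfl⟩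
    obtain ⟨⟨a, b⟩, rfl⟩ := MulEquiv.prodUnits.symm.surjective u
    refine ⟨(a.val * N * a⁻¹.val, b.val * A * b⁻¹.val),
      ⟨?_, ?_⟩, ?_⟩
    · obtain ⟨j, hj⟩ := hN
      exact ⟨j, by rw [Units.conj_pow, hj]; simp⟩
    · exact (b.isUnit.mul hA).mul b⁻¹.isUnit
    · rw [← map_inv]
      simp only [Units.coe_map]
      rw [← map_mul, ← map_mul]
      rfl
  · rintro g _ ⟨⟨N, A⟩, ⟨hN, hA⟩, rfl⟩ ⟨⟨N', A'⟩, ⟨hN', hA'⟩, h⟩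
    have h1 : fromBlocks N' 0 0 A' * g.val = g.val * fromBlocks N 0 0 A := by
      change fromBlocks N' 0 0 A' = _ * fromBlocks N 0 0 A * _ at h
      rw [h, Matrix.mul_assoc, g.inv_mul, Matrix.mul_one]
    have hg := fromBlocks_toBlocks g.val
    rw [← hg, fromBlocks_multiply, fromBlocks_multiply, fromBlocks_inj] at h1
    simp only [Matrix.zero_mul, Matrix.mul_zero, add_zero, zero_add] at h1
    obtain ⟨-, h12, h21, -⟩ := h1
    have e12 := eq_zero_of_isNilpotent_mul_eq_mul_isUnit hN' hA h12
    have e21 := eq_zero_of_isUnit_mul_eq_mul_isNilpotent hA' hN h21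
    rw [e12, e21] at hg
    have hdet : IsUnit (fromBlocks g.val.toBlocks₁₁ 0 0 g.val.toBlocks₂₂).det := by
      rw [hg]
      exact (isUnit_iff_isUnit_det _).1 g.isUnit
    rw [det_fromBlocks_zero₁₂, IsUnit.mul_iff, ← isUnit_iff_isUnit_det,
      ← isUnit_iff_isUnit_det] at hdet
    refine ⟨MulEquiv.prodUnits.symm (hdet.1.unit, hdet.2.unit), ?_⟩
    ext1
    exact hg

section Reindex

theorem card_isNilpotent_congr (e : ι ≃ κ) :
    Nat.card {N : Matrix ι ι F | IsNilpotent N} = Nat.card {N : Matrix κ κ F | IsNilpotent N} :=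
  Nat.card_congr ((reindexAlgEquiv F F e).toEquiv.subtypeEquiv fun _ =>
    (IsNilpotent.map_iff (reindexAlgEquiv F F e).injective).symm)

theorem card_GL_congr (e : ι ≃ κ) : Nat.card (GL ι F) = Nat.card (GL κ F) :=
  Nat.card_congr (Units.mapEquiv (reindexAlgEquiv F F e).toMulEquiv).toEquiv

theorem card_natTrailingDegree_congr (e : ι ≃ κ) (k : ℕ) :
    Nat.card {T : Matrix ι ι F | T.charpoly.natTrailingDegree = k} =
      Nat.card {T : Matrix κ κ F | T.charpoly.natTrailingDegree = k} :=
  Nat.card_congr ((reindex e e).subtypeEquiv fun T => by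
    rw [Set.mem_ofPred_eq, Set.mem_ofPred_eq, charpoly_reindex])

end Reindex

variable [Finite F]

theorem card_matrix_eq_sum_natTrailingDegree (n : ℕ) :
    Nat.card F ^ (n * n) = ∑ k ∈ Finset.range (n + 1),
      Nat.card {T : Matrix (Fin n) (Fin n) F | T.charpoly.natTrailingDegree = k} := by
  classical
  have : Fintype F := Fintype.ofFinite F
  have h1 : Nat.card (Matrix (Fin n) (Fin n) F) = Nat.card F ^ (n * n) := by
    rw [Matrix, Nat.card_fun, Nat.card_fun, Nat.card_fin, ← pow_mul]
  rw [← h1, Nat.card_eq_fintype_card, ← Finset.card_univ, Finset.card_eq_sum_card_fiberwise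
    (f := fun T : Matrix (Fin n) (Fin n) F => T.charpoly.natTrailingDegree)
    (t := Finset.range (n + 1))]
  · refine Finset.sum_congr rfl fun k _ => ?_
    rw [Nat.card_eq_fintype_card, Fintype.card_subtype]
    rfl
  · intro T _
    have := T.charpoly.natTrailingDegree_le_natDegree
    rw [charpoly_natDegree_eq_dim, Fintype.card_fin] at this
    exact Finset.mem_coe.2 (Finset.mem_range_succ_iff.2 this)

theorem eval_glPoly_eq_card (n : ℕ) :
    (glPoly n).eval (Nat.card F : ℤ) = Nat.card (GL (Fin n) F) := by
  have : Fintype F := Fintype.ofFinite F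
  rw [card_GL_field, glPoly_eq_prod, eval_prod, Nat.cast_prod, Finset.prod_range]
  refine Finset.prod_congr rfl fun i _ => ?_
  rw [Nat.card_eq_fintype_card, Nat.cast_sub (Nat.pow_le_pow_right Fintype.card_pos i.2.le)]
  simp

theorem card_GL_succ (n : ℕ) : (Nat.card (GL (Fin (n + 1)) F) : ℚ) =
    (Nat.card F : ℚ) ^ n * ((Nat.card F : ℚ) ^ (n + 1) - 1) * Nat.card (GL (Fin n) F) := by
  have h : glPoly (n + 1) = X ^ n * (X ^ (n + 1) - 1) * glPoly n := by
    rw [glPoly, glPoly, qFactorial_succ, Nat.choose_succ_succ' n 1, Nat.choose_one_right, pow_add]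
    ring
  have h1 : (Nat.card (GL (Fin (n + 1)) F) : ℤ) =
      (Nat.card F : ℤ) ^ n * ((Nat.card F : ℤ) ^ (n + 1) - 1) * Nat.card (GL (Fin n) F) := by
    rw [← eval_glPoly_eq_card, ← eval_glPoly_eq_card, h]
    simp
  exact_mod_cast congrArg (Int.cast : ℤ → ℚ) h1

/-- The number of nilpotent matrices over a finite field (Fine and Herstein). -/
theorem card_isNilpotent (n : ℕ) :
    Nat.card {N : Matrix (Fin n) (Fin n) F | IsNilpotent N} = Nat.card F ^ (n * n - n) := by
  have hGL (n : ℕ) : (Nat.card (GL (Fin n) F) : ℚ) ≠ 0 := by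
    have : Nat.card (GL (Fin n) F) ≠ 0 := Nat.card_pos.ne'
    exact_mod_cast this
  have hsum (n : ℕ) : (Nat.card F : ℚ) ^ (n * n) / Nat.card (GL (Fin n) F) =
      ∑ k ∈ Finset.range (n + 1), (Nat.card {N : Matrix (Fin k) (Fin k) F | IsNilpotent N} : ℚ) /
        Nat.card (GL (Fin k) F) := by
    rw [← Nat.cast_pow, card_matrix_eq_sum_natTrailingDegree, Nat.cast_sum, Finset.sum_div]
    refine Finset.sum_congr rfl fun k hk => ?_
    have hk' : k + (n - k) = n := by simp at hk; omega
    have e : Fin k ⊕ Fin (n - k) ≃ Fin n := finSumFinEquiv.trans (finCongr hk')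
    have h := card_natTrailingDegree_charpoly_eq (F := F) (ι := Fin k) (κ := Fin (n - k))
    rw [card_natTrailingDegree_congr e, card_GL_congr e, Fintype.card_fin] at h
    rw [div_eq_div_iff (hGL n) (hGL k)]
    apply mul_right_cancel₀ (hGL (n - k))
    have h' := congrArg (Nat.cast : ℕ → ℚ) h
    push_cast at h'
    linear_combination h'
  rcases n with - | n
  · have : Nat.card {N : Matrix (Fin 0) (Fin 0) F | IsNilpotent N} = 1 := by
      rw [Nat.card_eq_one_iff_unique]
      exact ⟨⟨fun a b => Subtype.ext (Subsingleton.elim _ _)⟩, ⟨0, IsNilpotent.zero⟩⟩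
    rw [this]
    simp
  · have h1 := hsum (n + 1)
    rw [Finset.sum_range_succ, ← hsum n, card_GL_succ] at h1
    have hne : (Nat.card F : ℚ) ^ n * ((Nat.card F : ℚ) ^ (n + 1) - 1) ≠ 0 := by
      have := hGL (n + 1)
      rw [card_GL_succ] at this
      exact left_ne_zero_of_mul this
    have hn := hGL n
    have e1 : (n + 1) * (n + 1) - (n + 1) = n * n + n := by
      rw [← Nat.mul_sub_one]; simp; ring
    have e2 : (n + 1) * (n + 1) = n * n + n + (n + 1) := by ring
    have : (Nat.card {N : Matrix (Fin (n + 1)) (Fin (n + 1)) F | IsNilpotent N} : ℚ) =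
        (Nat.card F : ℚ) ^ ((n + 1) * (n + 1) - (n + 1)) := by
      rw [e1]
      rw [e2, div_eq_iff (mul_ne_zero hne hn), add_mul, div_mul_cancel₀ _ (mul_ne_zero hne hn),
        mul_comm (_ / _), mul_assoc, mul_div_cancel₀ _ hn] at h1
      linear_combination -h1
    exact_mod_cast this

end Matrix

namespace Matrix

section Equiv

variable {F : Type*} [Field F] {ι α : Type*} [LinearOrder α]

/-- A block triangular matrix consists of its diagonal blocks and its entries above them. -/
def blockTriangularEquiv (b : ι → α) (Q : ∀ t, Set (Matrix {i // b i = t} {i // b i = t} F)) :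
    {M : Matrix ι ι F | M.BlockTriangular b ∧ ∀ t, M.toSquareBlock b t ∈ Q t} ≃
      (∀ t, Q t) × ({p : ι × ι // b p.1 < b p.2} → F) where
  toFun M := (fun t => ⟨M.1.toSquareBlock b t, M.2.2 t⟩, fun p => M.1 p.1.1 p.1.2)
  invFun A := ⟨of fun i j => if h : b i = b j then (A.1 (b j)).1 ⟨i, h⟩ ⟨j, rfl⟩ else
      if h : b i < b j then A.2 ⟨(i, j), h⟩ else 0, fun i j h => by
        rw [of_apply, dif_neg h.ne', dif_neg h.not_gt], fun t => by
        convert (A.1 t).2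
        ext ⟨i, hi⟩ ⟨j, hj⟩
        subst hj
        simp [toSquareBlock_def, hi]⟩
  left_inv M := by
    ext i j
    simp only [of_apply, toSquareBlock_def]
    split_ifs with h1 h2
    · rfl
    · rfl
    · exact (M.2.1 (lt_of_le_of_ne (not_lt.1 h2) (Ne.symm h1))).symm
  right_inv A := by
    refine Prod.ext ?_ ?_
    · funext t
      ext ⟨i, hi⟩ ⟨j, hj⟩
      subst hj
      simp [toSquareBlock_def, hi]
    · funext p
      simp [p.2, p.2.ne]

theorem card_blockTriangular [Fintype α] (b : ι → α)
    (Q : ∀ t, Set (Matrix {i // b i = t} {i // b i = t} F)) :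
    Nat.card {M : Matrix ι ι F | M.BlockTriangular b ∧ ∀ t, M.toSquareBlock b t ∈ Q t} =
      (∏ t, Nat.card (Q t)) * Nat.card ({p : ι × ι // b p.1 < b p.2} → F) := by
  rw [Nat.card_congr (blockTriangularEquiv b Q), Nat.card_prod, Nat.card_pi]

end Equiv

variable {F : Type*} [Field F] {ι α : Type*} [Fintype ι] [DecidableEq ι] [Fintype α] [LinearOrder α]

theorem BlockTriangular.isNilpotent_iff {M : Matrix ι ι F} {b : ι → α} (hM : M.BlockTriangular b) :
    IsNilpotent M ↔ ∀ t, IsNilpotent (M.toSquareBlock b t) := by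
  have hχ : M.charpoly = ∏ t, (M.toSquareBlock b t).charpoly := by
    simp only [Matrix.charpoly, hM.charmatrix.det_fintype, charmatrix_toSquareBlock]
  constructor
  · intro h t
    have hd : (M.toSquareBlock b t).charpoly ∣ X ^ Fintype.card ι := by
      rw [← (isNilpotent_iff_charpoly_eq M).1 h, hχ]
      exact Finset.dvd_prod_of_mem _ (Finset.mem_univ t)
    obtain ⟨k, -, hk⟩ := (dvd_prime_pow prime_X _).1 hd
    have hk' := eq_of_monic_of_associated (charpoly_monic _) (monic_X_pow k) hk
    refine ⟨k, ?_⟩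
    have := (M.toSquareBlock b t).aeval_self_charpoly
    rwa [hk', map_pow, aeval_X] at this
  · intro h
    have h2 : M.charpoly = X ^ ∑ t, Fintype.card {i // b i = t} := by
      rw [hχ, ← Finset.prod_pow_eq_pow_sum]
      exact Finset.prod_congr rfl fun t _ => (isNilpotent_iff_charpoly_eq _).1 (h t)
    refine ⟨∑ t, Fintype.card {i // b i = t}, ?_⟩
    have := M.aeval_self_charpoly
    rwa [h2, map_pow, aeval_X] at this

theorem BlockTriangular.isUnit_iff {M : Matrix ι ι F} {b : ι → α} (hM : M.BlockTriangular b) :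
    IsUnit M ↔ ∀ t, IsUnit (M.toSquareBlock b t) := by
  simp_rw [isUnit_iff_isUnit_det, hM.det_fintype, isUnit_iff_ne_zero, Finset.prod_ne_zero_iff,
    Finset.mem_univ, true_imp_iff]

variable [Finite F]

/-- The quotient of the numbers of nilpotent and of invertible block triangular matrices. -/
theorem card_blockTriangular_isNilpotent_mul (b : ι → α) :
    Nat.card {M : Matrix ι ι F | M.BlockTriangular b ∧ IsNilpotent M} *
        ∏ t, Nat.card (GL (Fin (Nat.card {i // b i = t})) F) =
      Nat.card {M : Matrix ι ι F | M.BlockTriangular b ∧ IsUnit M} *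
        ∏ t, Nat.card F ^ (Nat.card {i // b i = t} * Nat.card {i // b i = t} -
          Nat.card {i // b i = t}) := by
  have h1 : {M : Matrix ι ι F | M.BlockTriangular b ∧ IsNilpotent M} =
      {M | M.BlockTriangular b ∧ ∀ t, M.toSquareBlock b t ∈ {N | IsNilpotent N}} :=
    Set.ext fun M => and_congr_right fun hM => hM.isNilpotent_iff
  have h2 : {M : Matrix ι ι F | M.BlockTriangular b ∧ IsUnit M} =
      {M | M.BlockTriangular b ∧ ∀ t, M.toSquareBlock b t ∈ {N | IsUnit N}} :=
    Set.ext fun M => and_congr_right fun hM => hM.isUnit_iff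
  have h3 (t : α) : Nat.card {N : Matrix {i // b i = t} {i // b i = t} F | IsNilpotent N} =
      Nat.card F ^ (Nat.card {i // b i = t} * Nat.card {i // b i = t} -
        Nat.card {i // b i = t}) := by
    rw [← card_isNilpotent]
    exact card_isNilpotent_congr (Finite.equivFin _)
  have h4 (t : α) : Nat.card {N : Matrix {i // b i = t} {i // b i = t} F | IsUnit N} =
      Nat.card (GL (Fin (Nat.card {i // b i = t})) F) := by
    rw [← card_GL_congr (Finite.equivFin {i // b i = t})]
    exact Nat.card_congr ⟨fun N => N.2.unit, fun g => ⟨g, g.isUnit⟩, fun N => by simp,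
      fun g => by simp⟩
  rw [h1, h2, card_blockTriangular, card_blockTriangular]
  simp_rw [h3, h4]
  ring

end Matrix

section Parabolic

variable {n : ℕ}

theorem single_mem_standardFlag {R : Type*} [CommRing R] {j : ℕ} {b : Fin n} (hb : (b : ℕ) < j)
    (c : R) : Pi.single b c ∈ standardFlag n R j := by
  intro a ha
  rw [Pi.single_apply, if_neg]
  rintro rfl
  omega

theorem mulVec_mem_standardFlag {R : Type*} [CommRing R] {j : ℕ} {M : Matrix (Fin n) (Fin n) R}
    (hM : ∀ a b : Fin n, j ≤ a → (b : ℕ) < j → M a b = 0) {v : Fin n → R}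
    (hv : v ∈ standardFlag n R j) : M.mulVec v ∈ standardFlag n R j := by
  intro a ha
  change ∑ b, M a b * v b = 0
  refine Finset.sum_eq_zero fun b _ => ?_
  rcases lt_or_ge (b : ℕ) j with hb | hb
  · rw [hM a b ha hb, zero_mul]
  · rw [hv b hb, mul_zero]

theorem mem_submoduleStabilizer_standardFlag {R : Type*} [CommRing R] (j : ℕ)
    (g : GL (Fin n) R) :
    g ∈ submoduleStabilizer (standardFlag n R j) ↔
      ∀ a b : Fin n, j ≤ a → (b : ℕ) < j → g.val a b = 0 := by
  constructor
  · intro h a b ha hb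
    have h1 : g.val.mulVec (Pi.single b 1) ∈ standardFlag n R j := by
      have h' : (standardFlag n R j).map g.val.mulVecLin = standardFlag n R j := h
      rw [← h']
      exact Submodule.mem_map_of_mem (f := g.val.mulVecLin) (single_mem_standardFlag hb 1)
    have h2 := h1 a ha
    rwa [Matrix.mulVec_single_one] at h2
  · intro h
    have hinv : ∀ a b : Fin n, j ≤ a → (b : ℕ) < j → g⁻¹.val a b = 0 := by
      have hbt : g.val.BlockTriangular (fun a : Fin n => if j ≤ (a : ℕ) then 1 else 0) := by
        intro a b hab
        refine h a b ?_ ?_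
        · by_contra ha
          simp [ha] at hab
        · by_contra hb
          simp only [not_lt] at hb
          simp only [hb] at hab
          split_ifs at hab <;> simp at hab
      let : Invertible g.val := g.invertible
      have := Matrix.blockTriangular_inv_of_blockTriangular hbt
      intro a b ha hb
      rw [Matrix.coe_units_inv]
      exact this (by simp [ha, hb])
    change (standardFlag n R j).map g.val.mulVecLin = standardFlag n R j
    refine le_antisymm ?_ fun v hv => ?_
    · rintro _ ⟨v, hv, rfl⟩
      exact mulVec_mem_standardFlag h hv
    · refine ⟨g⁻¹.val.mulVec v, mulVec_mem_standardFlag hinv hv, ?_⟩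
      rw [Matrix.mulVecLin_apply, Matrix.mulVec_mulVec, Units.mul_inv, Matrix.one_mulVec]

open Classical in
/-- The number of the diagonal block of `P_J` that contains the entry `(a, a)`. -/
noncomputable def blockIndex (J : Set (Fin (n - 1))) (a : Fin n) : Fin n :=
  ⟨(Finset.univ.filter fun i : Fin (n - 1) => i ∉ J ∧ (i : ℕ) < a).card, by
    refine lt_of_le_of_lt ?_ a.2
    rw [← Finset.card_map Fin.valEmbedding]
    refine (Finset.card_le_card (t := Finset.range a) ?_).trans (Finset.card_range _).le
    intro x hx
    obtain ⟨i, hi, rfl⟩ := Finset.mem_map.1 hx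
    exact Finset.mem_range.2 (Finset.mem_filter.1 hi).2.2⟩

theorem blockIndex_lt_iff (J : Set (Fin (n - 1))) (a b : Fin n) :
    blockIndex J b < blockIndex J a ↔ ∃ i ∉ J, (b : ℕ) ≤ i ∧ (i : ℕ) < a := by
  classical
  have hmono {a b : Fin n} (h : a ≤ b) :
      (Finset.univ.filter fun i : Fin (n - 1) => i ∉ J ∧ (i : ℕ) < a) ⊆
      (Finset.univ.filter fun i : Fin (n - 1) => i ∉ J ∧ (i : ℕ) < b) :=
    Finset.monotone_filter_right _ fun i _ hi => ⟨hi.1, lt_of_lt_of_le hi.2 h⟩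
  rw [Fin.lt_def]
  simp only [blockIndex]
  constructor
  · intro h
    by_contra! hn
    refine h.not_ge (Finset.card_le_card fun i hi => ?_)
    simp only [Finset.mem_filter, Finset.mem_univ, true_and] at hi ⊢
    refine ⟨hi.1, ?_⟩
    by_contra hb
    exact (hn i hi.1 (not_lt.1 hb)).not_gt hi.2
  · rintro ⟨i, hi, hb, ha⟩
    refine Finset.card_lt_card ((hmono (hb.trans ha.le)).ssubset_of_mem_notMem (a := i) ?_ ?_)
    · simp [hi, ha]
    · simp [hb]

theorem blockIndex_mono (J : Set (Fin (n - 1))) : Monotone (blockIndex J) := by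
  intro a b hab
  by_contra h
  obtain ⟨i, -, h1, h2⟩ := (blockIndex_lt_iff J a b).1 (not_le.1 h)
  exact absurd (Fin.le_def.1 hab) (by omega)

theorem mem_standardParabolic {F : Type u} [Field F] (J : Set (Fin (n - 1))) {R : Type u}
    [CommRing R] [Algebra F R] (g : GL (Fin n) R) :
    g ∈ standardParabolic n F J R ↔ g.val.BlockTriangular (blockIndex J) := by
  simp only [standardParabolic, Subgroup.mem_iInf, mem_submoduleStabilizer_standardFlag]
  constructor
  · intro h a b hab
    obtain ⟨i, hi, hb, ha⟩ := (blockIndex_lt_iff J a b).1 hab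
    exact h i hi a b ha (by omega)
  · intro h i hi a b ha hb
    exact h ((blockIndex_lt_iff J a b).2 ⟨i, hi, by omega, by omega⟩)

section Field

variable {F : Type u} [Field F]

theorem dualNumber_one_add_apply (x : Matrix (Fin n) (Fin n) F) {a b : Fin n} (hab : a ≠ b) :
    (1 + (DualNumber.eps : DualNumber F) • x.map (algebraMap F (DualNumber F))) a b = 0 ↔
      x a b = 0 := by
  have h : (1 + (DualNumber.eps : DualNumber F) • x.map (algebraMap F (DualNumber F))) a b =
      TrivSqZeroExt.inr (x a b) := by
    rw [Matrix.add_apply, Matrix.one_apply_ne hab, zero_add, Matrix.smul_apply, Matrix.map_apply]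
    rw [smul_eq_mul, TrivSqZeroExt.algebraMap_eq_inl, DualNumber.eps, TrivSqZeroExt.inr_mul_inl,
      op_smul_eq_mul, one_mul]
  rw [h]
  exact TrivSqZeroExt.inr_injective.eq_iff' (TrivSqZeroExt.inr_zero F)

theorem exists_GL_dualNumber (x : Matrix (Fin n) (Fin n) F) :
    ∃ g : GL (Fin n) (DualNumber F), (g : Matrix (Fin n) (Fin n) (DualNumber F)) =
      1 + (DualNumber.eps : DualNumber F) • x.map (algebraMap F (DualNumber F)) := by
  set y := (DualNumber.eps : DualNumber F) • x.map (algebraMap F (DualNumber F)) with hy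
  have h : y * y = 0 := by
    rw [hy, Matrix.smul_mul, Matrix.mul_smul, smul_smul, DualNumber.eps_mul_eps, zero_smul]
  refine ⟨⟨1 + y, 1 - y, ?_, ?_⟩, rfl⟩
  · noncomm_ring
    simp [h]
  · noncomm_ring
    simp [h]

theorem mem_lieAlgebra_standardParabolic (J : Set (Fin (n - 1))) (x : Matrix (Fin n) (Fin n) F) :
    x ∈ lieAlgebra (standardParabolic n F J) ↔ x.BlockTriangular (blockIndex J) := by
  have key : (1 + (DualNumber.eps : DualNumber F) •
      x.map (algebraMap F (DualNumber F))).BlockTriangular (blockIndex J) ↔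
      x.BlockTriangular (blockIndex J) := by
    have hne {a b : Fin n} (h : blockIndex J b < blockIndex J a) : a ≠ b := by
      rintro rfl
      exact lt_irrefl _ h
    exact ⟨fun h a b hab => (dualNumber_one_add_apply x (hne hab)).1 (h hab),
      fun h a b hab => (dualNumber_one_add_apply x (hne hab)).2 (h hab)⟩
  constructor
  · rintro ⟨g, hg, h⟩
    rw [mem_standardParabolic, h] at hg
    exact key.1 hg
  · intro hx
    obtain ⟨g, hg⟩ := exists_GL_dualNumber x
    refine ⟨g, ?_, hg⟩
    rw [mem_standardParabolic, hg]
    exact key.2 hx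

theorem conjSubgroup_one (P : GLSubgroup n F) : conjSubgroup 1 P = P := by
  funext R _ _
  ext g
  simp [conjSubgroup, Subgroup.mem_map]

theorem conjSubgroup_mul (g h : GL (Fin n) F) (P : GLSubgroup n F) :
    conjSubgroup (g * h) P = conjSubgroup g (conjSubgroup h P) := by
  funext R _ _
  simp only [conjSubgroup, map_mul, Subgroup.map_map]
  rfl

theorem conj_mem_lieAlgebra (g : GL (Fin n) F) {P : GLSubgroup n F} {x : Matrix (Fin n) (Fin n) F}
    (hx : x ∈ lieAlgebra P) : g.val * x * g⁻¹.val ∈ lieAlgebra (conjSubgroup g P) := by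
  obtain ⟨p, hp, h⟩ := hx
  set γ := Matrix.GeneralLinearGroup.map (n := Fin n) (algebraMap F (DualNumber F)) g with hγ
  refine ⟨γ * p * γ⁻¹, ⟨p, hp, rfl⟩, ?_⟩
  have e1 : γ.val = g.val.map (algebraMap F (DualNumber F)) := rfl
  have e2 : γ⁻¹.val = g⁻¹.val.map (algebraMap F (DualNumber F)) := rfl
  rw [Units.val_mul, Units.val_mul, h, Matrix.map_mul, Matrix.map_mul, ← e1, ← e2, Matrix.mul_add,
    Matrix.add_mul, Matrix.mul_one, Units.mul_inv, Matrix.mul_smul, Matrix.smul_mul]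

theorem conj_mem_lieAlgebra_iff (g : GL (Fin n) F) (P : GLSubgroup n F)
    (x : Matrix (Fin n) (Fin n) F) :
    g.val * x * g⁻¹.val ∈ lieAlgebra (conjSubgroup g P) ↔ x ∈ lieAlgebra P := by
  refine ⟨fun h => ?_, conj_mem_lieAlgebra g⟩
  have := conj_mem_lieAlgebra g⁻¹ h
  rw [← conjSubgroup_mul, inv_mul_cancel, conjSubgroup_one, inv_inv] at this
  convert this using 1
  simp [Matrix.mul_assoc]

/-- A subspace that is stable under all upper unitriangular transvections belongs to the standard
full flag. -/
theorem exists_eq_standardFlag {E : Submodule F (Fin n → F)}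
    (hE : ∀ v ∈ E, ∀ a b : Fin n, a < b → Pi.single a (v b) ∈ E) :
    ∃ k, E = standardFlag n F k := by
  classical
  have hex : ∃ k, E ≤ standardFlag n F k := ⟨n, fun v _ a ha => absurd a.2 (by omega)⟩
  have hk := Nat.find_spec hex
  refine ⟨Nat.find hex, le_antisymm hk fun w hw => ?_⟩
  rcases hk0 : Nat.find hex with - | k
  · rw [hk0] at hw
    have : w = 0 := funext fun a => hw a (Nat.zero_le _)
    rw [this]
    exact E.zero_mem
  rw [hk0] at hk hw
  have hmin := Nat.find_min hex (m := k) (by omega)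
  obtain ⟨v, hv, hvk⟩ := SetLike.not_le_iff_exists.1 hmin
  obtain ⟨b, hb, hvb⟩ : ∃ b : Fin n, k ≤ b ∧ v b ≠ 0 := by
    by_contra! h
    exact hvk fun a ha => h a ha
  have hbk : (b : ℕ) = k := by
    by_contra h
    exact hvb (hk hv b (by omega))
  have hlt (a : Fin n) (ha : a < b) (c : F) : Pi.single a c ∈ E := by
    have := E.smul_mem (c / v b) (hE v hv a b ha)
    rwa [← Pi.single_smul, smul_eq_mul, div_mul_cancel₀ _ hvb] at this
  have hsum (u : Fin n → F) (hu : u ∈ standardFlag n F (k + 1)) :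
      u - Pi.single b (u b) ∈ E := by
    have hu' (w : Fin n → F) (h : ∀ a, Pi.single a (w a) ∈ E) : w ∈ E :=
      Finset.univ_sum_single w ▸ E.sum_mem fun a _ => h a
    refine hu' _ fun a => ?_
    rcases lt_trichotomy a b with h | rfl | h
    · exact hlt a h _
    · simp
    · have h1 : u a = 0 := hu a (by rw [Fin.lt_def] at h; omega)
      simp [h1, h.ne']
  have hb1 : Pi.single b (v b) ∈ E := by
    simpa using E.sub_mem hv (hsum v (hk hv))
  have hb2 : Pi.single b (w b) ∈ E := by
    have := E.smul_mem (w b / v b) hb1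
    rwa [← Pi.single_smul, smul_eq_mul, div_mul_cancel₀ _ hvb] at this
  simpa using E.add_mem (hsum w hw) hb2

theorem standardFlag_mono {R : Type*} [CommRing R] : Monotone (standardFlag n R) :=
  fun _ _ h _ hv a ha => hv a (h.trans ha)

/-- The standard parabolic subgroups are their own normalizers. -/
theorem mem_standardParabolic_of_conjSubgroup_eq (J : Set (Fin (n - 1))) (g : GL (Fin n) F)
    (hg : conjSubgroup g (standardParabolic n F J) = standardParabolic n F J) :
    g ∈ standardParabolic n F J F := by
  have hconj (p : GL (Fin n) F) (hp : p ∈ standardParabolic n F J F) :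
      ∃ p' ∈ standardParabolic n F J F, p * g = g * p' := by
    have h1 : p ∈ conjSubgroup g (standardParabolic n F J) F := by rwa [hg]
    obtain ⟨p', hp', rfl⟩ := h1
    refine ⟨p', hp', ?_⟩
    simp
  simp only [standardParabolic, Subgroup.mem_iInf] at hconj ⊢
  intro i hi
  set E := standardFlag n F (i + 1) with hE
  have hstab : ∀ v ∈ E.map g.val.mulVecLin, ∀ a b : Fin n, a < b →
      Pi.single a (v b) ∈ E.map g.val.mulVecLin := by
    rintro _ ⟨v, hv, rfl⟩ a b hab
    set w := g.val.mulVecLin v with hw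
    obtain ⟨t, ht⟩ : ∃ t : GL (Fin n) F, t.val = Matrix.transvection a b 1 :=
      ⟨Matrix.GeneralLinearGroup.mkOfDetNeZero (Matrix.transvection a b 1) (by
        rw [Matrix.det_transvection_of_ne _ _ hab.ne]
        exact one_ne_zero), rfl⟩
    have htJ : t ∈ standardParabolic n F J F := by
      rw [mem_standardParabolic, ht]
      intro c d hcd
      have hdc : d < c := (blockIndex_mono J).reflect_lt hcd
      rw [Matrix.transvection, Matrix.add_apply, Matrix.one_apply_ne hdc.ne',
        Matrix.single_apply, if_neg, add_zero]
      rintro ⟨rfl, rfl⟩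
      exact hab.not_gt hdc
    simp only [standardParabolic, Subgroup.mem_iInf] at htJ
    obtain ⟨p', hp', hpg⟩ := hconj t htJ
    have hp'' : E.map p'.val.mulVecLin = E := hp' i hi
    have h1 : t.val.mulVec w ∈ E.map g.val.mulVecLin := by
      refine ⟨p'.val.mulVec v, ?_, ?_⟩
      · rw [← hp'']
        exact Submodule.mem_map_of_mem (f := p'.val.mulVecLin) hv
      · rw [hw, Matrix.mulVecLin_apply, Matrix.mulVecLin_apply, Matrix.mulVec_mulVec,
          Matrix.mulVec_mulVec, ← Units.val_mul, ← Units.val_mul, hpg]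
    have h2 : t.val.mulVec w = w + Pi.single a (w b) := by
      rw [ht, Matrix.transvection, Matrix.add_mulVec, Matrix.one_mulVec, Matrix.single_mulVec,
        one_mul]
      rfl
    rw [h2] at h1
    simpa using Submodule.sub_mem _ h1 ⟨v, hv, hw.symm⟩
  obtain ⟨k, hk⟩ := exists_eq_standardFlag hstab
  have hinj : Function.Injective g.val.mulVecLin := by
    rw [Matrix.coe_mulVecLin]
    exact Matrix.mulVec_injective_of_isUnit g.isUnit
  have hrank : Module.finrank F (E.map g.val.mulVecLin) = Module.finrank F E :=
    (Submodule.equivMapOfInjective _ hinj E).finrank_eq.symm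
  change E.map g.val.mulVecLin = E
  rcases le_total k (i + 1) with h | h
  · exact Submodule.eq_of_le_of_finrank_eq (hk ▸ standardFlag_mono h) hrank
  · exact (Submodule.eq_of_le_of_finrank_eq (hk ▸ standardFlag_mono h) hrank.symm).symm

theorem conjSubgroup_standardParabolic (J : Set (Fin (n - 1))) {g : GL (Fin n) F}
    (hg : g ∈ standardParabolic n F J F) :
    conjSubgroup g (standardParabolic n F J) = standardParabolic n F J := by
  funext R _ _
  set γ := Matrix.GeneralLinearGroup.map (n := Fin n) (algebraMap F R) g with hγ
  have hγJ : γ ∈ standardParabolic n F J R := by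
    rw [mem_standardParabolic] at hg ⊢
    intro a b hab
    change algebraMap F R (g.val a b) = 0
    rw [hg hab, map_zero]
  exact Subgroup.mem_normalizer_iff_map_conj_eq.1 (Subgroup.le_normalizer hγJ)

variable [Finite F]

/-- The number of points of the generalized Springer variety. -/
theorem card_springerVariety_mul (J : Set (Fin (n - 1))) :
    Nat.card (springerVariety n F J) *
        ∏ t, Nat.card (GL (Fin (Nat.card {a // blockIndex J a = t})) F) =
      Nat.card (GL (Fin n) F) * ∏ t, Nat.card F ^
        (Nat.card {a // blockIndex J a = t} * Nat.card {a // blockIndex J a = t} -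
          Nat.card {a // blockIndex J a = t}) := by
  set P := standardParabolic n F J with hP
  set D : Set (Matrix (Fin n) (Fin n) F × GLSubgroup n F) :=
    (fun x => (x, P)) '' {x | x.BlockTriangular (blockIndex J) ∧ IsNilpotent x} with hD
  have key := card_saturation_mul_card (fun (g : GL (Fin n) F)
      (p : Matrix (Fin n) (Fin n) F × GLSubgroup n F) =>
      (g.val * p.1 * g⁻¹.val, conjSubgroup g p.2))
    (fun p => by simp [conjSubgroup_one])
    (fun g h p => by simp [conjSubgroup_mul, Matrix.mul_assoc]) (P F) D ?_ ?_
  · have h1 : {x | ∃ g : GL (Fin n) F, ∃ d ∈ D,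
        ((g.val * d.1 * g⁻¹.val, conjSubgroup g d.2) :
          Matrix (Fin n) (Fin n) F × GLSubgroup n F) = x} = springerVariety n F J := by
      ext ⟨y, Q⟩
      constructor
      · rintro ⟨g, _, ⟨x, ⟨hx, j, hj⟩, rfl⟩, h⟩
        obtain ⟨rfl, rfl⟩ := Prod.ext_iff.1 h
        refine ⟨⟨g, rfl⟩, ⟨j, ?_⟩, ?_⟩
        · simp only
          rw [Units.conj_pow, hj]
          simp
        · exact conj_mem_lieAlgebra g ((mem_lieAlgebra_standardParabolic J x).2 hx)
      · rintro ⟨⟨g, rfl⟩, ⟨j, hj⟩, hy⟩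
        have hy' : g.val * (g⁻¹.val * y * g.val) * g⁻¹.val = y := by simp [Matrix.mul_assoc]
        refine ⟨g, _, ⟨g⁻¹.val * y * g.val, ⟨?_, j, ?_⟩, rfl⟩, Prod.ext hy' rfl⟩
        · rw [← mem_lieAlgebra_standardParabolic, ← conj_mem_lieAlgebra_iff g, hy']
          exact hy
        · rw [Units.conj_pow', hj]
          simp
    have h2 : Nat.card D = Nat.card {x : Matrix (Fin n) (Fin n) F |
        x.BlockTriangular (blockIndex J) ∧ IsNilpotent x} :=
      Nat.card_image_of_injective (fun x y h => congrArg Prod.fst h) _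
    have h3 : Nat.card (P F) = Nat.card {x : Matrix (Fin n) (Fin n) F |
        x.BlockTriangular (blockIndex J) ∧ IsUnit x} :=
      Nat.card_congr ⟨fun g => ⟨g.1.val, (mem_standardParabolic J g.1).1 g.2, g.1.isUnit⟩,
        fun x => ⟨x.2.2.unit, (mem_standardParabolic J _).2 x.2.1⟩, fun g => by simp,
        fun x => by simp⟩
    have h4 : 0 < Nat.card (P F) := Nat.card_pos
    have h5 := Matrix.card_blockTriangular_isNilpotent_mul (F := F) (blockIndex J)
    rw [h1, h2] at key
    rw [← h3] at h5
    refine Nat.eq_of_mul_eq_mul_right h4 ?_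
    calc _ = Nat.card (springerVariety n F J) * Nat.card (P F) *
        ∏ t, Nat.card (GL (Fin (Nat.card {a // blockIndex J a = t})) F) := by ring
      _ = _ := by rw [key, mul_assoc, h5]; ring
  · rintro h hh _ ⟨x, ⟨hx, j, hj⟩, rfl⟩
    have hP' := conjSubgroup_standardParabolic J hh
    refine ⟨h.val * x * h⁻¹.val, ⟨?_, j, ?_⟩, Prod.ext rfl hP'.symm⟩
    · rw [← mem_lieAlgebra_standardParabolic, ← hP']
      exact conj_mem_lieAlgebra h ((mem_lieAlgebra_standardParabolic J x).2 hx)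
    · rw [Units.conj_pow, hj]
      simp
  · rintro g _ ⟨x, -, rfl⟩ ⟨x', -, h⟩
    exact mem_standardParabolic_of_conjSubgroup_eq J g (congrArg Prod.snd h).symm

end Field

end Parabolic

section Fibers

variable {α β γ : Type*} [Fintype β] [Fintype γ]

/-- The cardinals of the non-empty fibres of a map. -/
noncomputable def fiberSizes (f : α → β) : Multiset ℕ :=
  (Finset.univ.val.map fun t => Nat.card {a // f a = t}).filter (· ≠ 0)

theorem fiberSizes_comp_injective (f : α → β) {e : β → γ} (he : Function.Injective e) :
    fiberSizes (e ∘ f) = fiberSizes f := by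
  classical
  have h1 (t : β) : Nat.card {a // (e ∘ f) a = e t} = Nat.card {a // f a = t} := by
    simp [he.eq_iff]
  have h2 : (Finset.univ.filter fun s : γ => Nat.card {a // (e ∘ f) a = s} ≠ 0) =
      (Finset.univ.filter fun t : β => Nat.card {a // f a = t} ≠ 0).map ⟨e, he⟩ := by
    ext s
    simp only [Finset.mem_filter, Finset.mem_univ, true_and, Finset.mem_map,
      Function.Embedding.coeFn_mk]
    constructor
    · intro h
      obtain ⟨⟨a, rfl⟩⟩ := (Nat.card_ne_zero.1 h).1
      exact ⟨f a, by rwa [← h1], rfl⟩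
    · rintro ⟨t, ht, rfl⟩
      rwa [h1]
  rw [fiberSizes, fiberSizes, Multiset.filter_map, Multiset.filter_map]
  change Multiset.map _ (Finset.univ.filter fun s : γ => Nat.card {a // (e ∘ f) a = s} ≠ 0).val =
    Multiset.map _ (Finset.univ.filter fun t : β => Nat.card {a // f a = t} ≠ 0).val
  rw [h2, Finset.map_val, Multiset.map_map]
  exact Multiset.map_congr rfl fun t _ => h1 t

@[to_additive]
theorem prod_map_fiberSizes {M : Type*} [CommMonoid M] (f : α → β) (g : ℕ → M) (hg : g 0 = 1) :
    ((fiberSizes f).map g).prod = ∏ t, g (Nat.card {a // f a = t}) := by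
  have h (s : Multiset ℕ) : ((s.filter (· ≠ 0)).map g).prod = (s.map g).prod := by
    induction s using Multiset.induction_on with
    | empty => simp
    | cons a s ih =>
      by_cases ha : a = 0
      · rw [Multiset.filter_cons_of_neg (p := (· ≠ 0)) _ (by simpa using ha), ih, Multiset.map_cons,
          Multiset.prod_cons, ha, hg, one_mul]
      · rw [Multiset.filter_cons_of_pos (p := (· ≠ 0)) _ ha, Multiset.map_cons, Multiset.prod_cons, ih,
          Multiset.map_cons, Multiset.prod_cons]
  rw [fiberSizes, h, Multiset.map_map]
  rfl

theorem sum_fiberSizes [Finite α] (f : α → β) : (fiberSizes f).sum = Nat.card α := by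
  have h2 : (fiberSizes f).sum = ∑ t, Nat.card {a // f a = t} := by
    simpa using sum_map_fiberSizes f id rfl
  rw [h2, ← Nat.card_sigma]
  exact Nat.card_congr (Equiv.sigmaFiberEquiv f)

theorem Multiset.eq_of_filter_ne_zero_eq {s t : Multiset ℕ}
    (h : s.filter (· ≠ 0) = t.filter (· ≠ 0)) (hc : Multiset.card s = Multiset.card t) : s = t := by
  have key (s : Multiset ℕ) : s = s.filter (· ≠ 0) + Multiset.replicate (s.count 0) 0 := by
    conv_lhs => rw [← Multiset.filter_add_not (· ≠ 0) s]
    congr 1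
    simp_rw [not_not]
    exact Multiset.filter_eq' s 0
  have hs := congrArg Multiset.card (key s)
  have ht := congrArg Multiset.card (key t)
  rw [Multiset.card_add, Multiset.card_replicate] at hs ht
  rw [h] at hs
  rw [key s, key t, h]
  congr 2
  omega

theorem exists_perm_of_map_univ_eq {g₁ g₂ : β → ℕ}
    (h : Finset.univ.val.map g₁ = Finset.univ.val.map g₂) :
    ∃ σ : Equiv.Perm β, ∀ t, g₂ (σ t) = g₁ t := by
  classical
  have hcard (k : ℕ) : Nat.card {t // g₁ t = k} = Nat.card {t // g₂ t = k} := by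
    have h1 (g : β → ℕ) : Nat.card {t // g t = k} = (Finset.univ.val.map g).count k := by
      rw [Multiset.count_map, Nat.card_eq_fintype_card, Fintype.card_subtype, Finset.card,
        Finset.filter_val]
      simp_rw [eq_comm]
    rw [h1, h1, h]
  have e (k : ℕ) : {t // g₁ t = k} ≃ {t // g₂ t = k} :=
    Classical.choice (Finite.card_eq.1 (hcard k))
  exact ⟨Equiv.ofFiberEquiv e, fun t => Equiv.ofFiberEquiv_map e t⟩

/-- Two maps have the same fibre sizes if and only if their fibres are permuted by a bijection of
the source. -/
theorem fiberSizes_eq_iff [Finite α] (f₁ f₂ : α → β) :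
    fiberSizes f₁ = fiberSizes f₂ ↔
      ∃ w : Equiv.Perm α, ∀ a b, f₂ (w a) = f₂ (w b) ↔ f₁ a = f₁ b := by
  classical
  constructor
  · intro h
    obtain ⟨σ, hσ⟩ := exists_perm_of_map_univ_eq
      (Multiset.eq_of_filter_ne_zero_eq h (by simp))
    have e (s : β) : {a // σ (f₁ a) = s} ≃ {a // f₂ a = s} := by
      refine Classical.choice (Finite.card_eq.1 ?_)
      rw [← σ.apply_symm_apply s, hσ]
      simp only [σ.apply_eq_iff_eq]
    refine ⟨Equiv.ofFiberEquiv e, fun a b => ?_⟩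
    rw [Equiv.ofFiberEquiv_map e a, Equiv.ofFiberEquiv_map e b, σ.apply_eq_iff_eq]
  · rintro ⟨w, hw⟩
    have hcard (a : α) : Nat.card {b // f₂ b = f₂ (w a)} = Nat.card {b // f₁ b = f₁ a} := by
      refine (Nat.card_congr (w.subtypeEquiv fun b => ?_)).symm
      rw [hw]
    let φ (t : Set.range f₁) : Set.range f₂ := ⟨f₂ (w t.2.choose), _, rfl⟩
    have hφ (a : α) : φ ⟨f₁ a, a, rfl⟩ = f₂ (w a) :=
      (hw _ _).2 (Set.mem_range_self (f := f₁) a).choose_spec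
    let e : Set.range f₁ ≃ Set.range f₂ := Equiv.ofBijective φ (by
      constructor
      · rintro ⟨_, a, rfl⟩ ⟨_, b, rfl⟩ h
        have := congrArg Subtype.val h
        rw [hφ, hφ, hw] at this
        exact Subtype.ext this
      · rintro ⟨_, b, rfl⟩
        refine ⟨⟨f₁ (w.symm b), _, rfl⟩, Subtype.ext ?_⟩
        rw [hφ, w.apply_symm_apply])
    have he (a : α) : e ⟨f₁ a, a, rfl⟩ = f₂ (w a) := hφ a
    let σ : Equiv.Perm β := e.extendSubtype
    have hσ (t : β) : Nat.card {b // f₂ b = σ t} = Nat.card {b // f₁ b = t} := by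
      by_cases ht : t ∈ Set.range f₁
      · obtain ⟨a, rfl⟩ := ht
        rw [← hcard, ← he]
        have := e.extendSubtype_apply_of_mem (f₁ a) ⟨a, rfl⟩
        simp only [σ, this]
      · have ht' : σ t ∉ Set.range f₂ := e.extendSubtype_not_mem t ht
        have : IsEmpty {b // f₁ b = t} := ⟨fun b => ht ⟨b.1, b.2⟩⟩
        have : IsEmpty {b // f₂ b = σ t} := ⟨fun b => ht' ⟨b.1, b.2⟩⟩
        simp
    rw [fiberSizes, fiberSizes]
    congr 1
    conv_rhs => rw [← Multiset.map_univ_val_equiv σ, Multiset.map_map]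
    exact Multiset.map_congr rfl fun t _ => (hσ t).symm

end Fibers

section Roots

variable {n : ℕ}

theorem glRoot_add (a b c : Fin n) : glRoot n a b + glRoot n b c = glRoot n a c := by
  simp [glRoot]

theorem neg_glRoot (a b : Fin n) : -glRoot n a b = glRoot n b a := by
  simp [glRoot]

theorem glRoot_comp_symm (w : Equiv.Perm (Fin n)) (a b : Fin n) :
    glRoot n a b ∘ w.symm = glRoot n (w a) (w b) := by
  funext c
  simp [glRoot, Pi.single_apply, Equiv.symm_apply_eq]

theorem glRoot_mem_closure_iff (J : Set (Fin (n - 1))) (a b : Fin n) :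
    glRoot n a b ∈ AddSubgroup.closure (glSimpleRoot n '' J) ↔
      blockIndex J a = blockIndex J b := by
  classical
  constructor
  · intro h
    set φ : (Fin n → ℤ) →+ ℤ :=
      { toFun := fun r => ∑ c ∈ Finset.univ.filter (fun c => blockIndex J c = blockIndex J a), r c
        map_zero' := by simp
        map_add' := fun r s => by simp [Finset.sum_add_distrib] } with hφ
    have hval (c d : Fin n) : φ (glRoot n c d) =
        (if blockIndex J c = blockIndex J a then 1 else 0) -
          (if blockIndex J d = blockIndex J a then 1 else 0) := by
      simp [hφ, glRoot]
    have hle : AddSubgroup.closure (glSimpleRoot n '' J) ≤ φ.ker := by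
      rw [AddSubgroup.closure_le]
      rintro _ ⟨i, hi, rfl⟩
      have heq : blockIndex J ⟨i, by omega⟩ = blockIndex J ⟨i + 1, by omega⟩ := by
        refine le_antisymm (blockIndex_mono J (Fin.le_def.2 (by simp))) (not_lt.1 fun h => ?_)
        obtain ⟨j, hj, h1, h2⟩ := (blockIndex_lt_iff J _ _).1 h
        obtain rfl : i = j := by
          ext
          simp only at h1 h2
          omega
        exact hj hi
      change φ (glRoot n _ _) = 0
      rw [hval, heq, sub_self]
    have h0 : φ (glRoot n a b) = 0 := hle h
    rw [hval, if_pos rfl] at h0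
    by_contra hne
    rw [if_neg (Ne.symm hne)] at h0
    simp at h0
  · have key (k : ℕ) : ∀ a b : Fin n, (b : ℕ) = a + k → blockIndex J a = blockIndex J b →
        glRoot n a b ∈ AddSubgroup.closure (glSimpleRoot n '' J) := by
      induction k with
      | zero =>
        intro a b hab _
        obtain rfl : b = a := Fin.ext hab
        simp [glRoot]
      | succ k ih =>
        intro a b hab h
        have hb := b.2
        let c : Fin n := ⟨a + k, by omega⟩
        have hac : a ≤ c := Fin.le_def.2 (by simp [c])
        have hcb : c ≤ b := Fin.le_def.2 (by simp [c]; omega)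
        have h1 : blockIndex J a = blockIndex J c :=
          le_antisymm (blockIndex_mono J hac) (h ▸ blockIndex_mono J hcb)
        have hi : (⟨a + k, by omega⟩ : Fin (n - 1)) ∈ J := by
          by_contra hi
          have := (blockIndex_lt_iff J b c).2 ⟨_, hi, le_rfl, by simp only; omega⟩
          rw [← h1, h] at this
          exact lt_irrefl _ this
        have h2 : glRoot n c b ∈ AddSubgroup.closure (glSimpleRoot n '' J) := by
          refine AddSubgroup.subset_closure ⟨_, hi, ?_⟩
          rw [glSimpleRoot]
          congr 1
          ext
          simp only
          omega
        rw [← glRoot_add a c b]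
        exact AddSubgroup.add_mem _ (ih a c rfl h1) h2
    intro h
    rcases le_total (a : ℕ) b with hab | hab
    · obtain ⟨k, hk⟩ := Nat.exists_eq_add_of_le hab
      exact key k a b hk h
    · obtain ⟨k, hk⟩ := Nat.exists_eq_add_of_le hab
      rw [← neg_glRoot]
      exact AddSubgroup.neg_mem _ (key k b a hk h.symm)

theorem glRoot_mem_leviRoots_iff (J : Set (Fin (n - 1))) {a b : Fin n} (hab : a ≠ b) :
    glRoot n a b ∈ leviRoots n J ↔ blockIndex J a = blockIndex J b := by
  rw [← glRoot_mem_closure_iff]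
  exact ⟨fun h => h.2, fun h => ⟨⟨a, b, hab, rfl⟩, h⟩⟩

theorem areAssociate_iff (J₁ J₂ : Set (Fin (n - 1))) :
    AreAssociate n J₁ J₂ ↔ fiberSizes (blockIndex J₁) = fiberSizes (blockIndex J₂) := by
  rw [fiberSizes_eq_iff, AreAssociate]
  refine exists_congr fun w => ?_
  have himg {a b : Fin n} (hab : a ≠ b) :
      glRoot n (w a) (w b) ∈ (fun r => r ∘ w.symm) '' leviRoots n J₁ ↔
        blockIndex J₁ a = blockIndex J₁ b := by
    rw [← glRoot_mem_leviRoots_iff J₁ hab, ← glRoot_comp_symm,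
      Function.Injective.mem_set_image (f := fun r : Fin n → ℤ => r ∘ w.symm)
        (w.symm.surjective.injective_comp_right)]
  constructor
  · intro h a b
    rcases eq_or_ne a b with rfl | hab
    · simp
    · rw [← himg hab, ← h, glRoot_mem_leviRoots_iff J₂ (w.injective.ne hab)]
  · intro h
    ext r
    constructor
    · rintro ⟨⟨a, b, hab, rfl⟩, hr⟩
      obtain ⟨a, rfl⟩ := w.surjective a
      obtain ⟨b, rfl⟩ := w.surjective b
      have hab' : a ≠ b := fun e => hab (congrArg w e)
      rw [himg hab', ← h]
      exact (glRoot_mem_closure_iff J₂ _ _).1 hr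
    · rintro ⟨_, ⟨⟨a, b, hab, rfl⟩, hr⟩, rfl⟩
      change glRoot n a b ∘ w.symm ∈ _
      rw [glRoot_comp_symm, glRoot_mem_leviRoots_iff J₂ (w.injective.ne hab), h]
      exact (glRoot_mem_closure_iff J₁ _ _).1 hr

/-- The composition of `n` formed by the parts of a partition in decreasing order. -/
def sortedComposition (ν : n.Partition) : Composition n where
  blocks := ν.parts.sort (· ≥ ·)
  blocks_pos hi := ν.parts_pos (by simpa using hi)
  blocks_sum := by
    rw [← Multiset.sum_coe, Multiset.sort_eq, ν.parts_sum]

theorem index_lt_index_iff (c : Composition n) (a b : Fin n) :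
    c.index b < c.index a ↔ ∃ k, (b : ℕ) < c.sizeUpTo k ∧ c.sizeUpTo k ≤ a := by
  constructor
  · intro h
    exact ⟨_, c.lt_sizeUpTo_index_succ b,
      (c.monotone_sizeUpTo (Nat.succ_le_of_lt h)).trans (c.sizeUpTo_index_le a)⟩
  · rintro ⟨k, hb, ha⟩
    have h1 := c.monotone_sizeUpTo.reflect_lt ((c.sizeUpTo_index_le b).trans_lt hb)
    have h2 := c.monotone_sizeUpTo.reflect_lt (ha.trans_lt (c.lt_sizeUpTo_index_succ a))
    rw [Fin.val_succ] at h2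
    exact Fin.lt_def.2 (by omega)

theorem blockIndex_partitionRoots_eq_iff (ν : n.Partition) (a b : Fin n) :
    blockIndex (partitionRoots ν) a = blockIndex (partitionRoots ν) b ↔
      (sortedComposition ν).index a = (sortedComposition ν).index b := by
  have key (a b : Fin n) : blockIndex (partitionRoots ν) b < blockIndex (partitionRoots ν) a ↔
      (sortedComposition ν).index b < (sortedComposition ν).index a := by
    rw [blockIndex_lt_iff, index_lt_index_iff]
    constructor
    · rintro ⟨i, hi, hb, ha⟩
      simp only [partitionRoots, Set.mem_ofPred_eq, not_forall, not_not] at hi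
      obtain ⟨k, hk⟩ := hi
      have hk' : (sortedComposition ν).sizeUpTo k = i + 1 := hk
      exact ⟨k, by omega, by omega⟩
    · rintro ⟨k, hb, ha⟩
      have hn := a.2
      refine ⟨⟨(sortedComposition ν).sizeUpTo k - 1, by omega⟩, ?_, ?_, ?_⟩
      · simp only [partitionRoots, Set.mem_ofPred_eq, not_forall, not_not]
        refine ⟨k, ?_⟩
        change (sortedComposition ν).sizeUpTo k = _
        omega
      · simp only
        omega
      · simp only
        omega
  rw [← not_iff_not, ← ne_eq, ← ne_eq, lt_or_lt_iff_ne.symm, lt_or_lt_iff_ne.symm, key, key]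

theorem fiberSizes_blockIndex_partitionRoots (ν : n.Partition) :
    fiberSizes (blockIndex (partitionRoots ν)) = ν.parts := by
  set c := sortedComposition ν with hc
  have h1 : fiberSizes (blockIndex (partitionRoots ν)) =
      fiberSizes (Fin.castLE c.length_le ∘ c.index) := by
    rw [fiberSizes_eq_iff]
    refine ⟨1, fun a b => ?_⟩
    rw [blockIndex_partitionRoots_eq_iff]
    exact (Fin.castLE_injective c.length_le).eq_iff
  have h2 (i : Fin c.length) : Nat.card {a // c.index a = i} = c.blocksFun i := by
    rw [← Nat.card_fin (c.blocksFun i)]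
    exact Nat.card_congr ((c.blocksFinEquiv.symm.subtypeEquiv
      (q := fun s : Σ i, Fin (c.blocksFun i) => s.1 = i) fun a => Iff.rfl).trans
      (Equiv.sigmaSubtype i))
  rw [h1, fiberSizes_comp_injective _ (Fin.castLE_injective _), fiberSizes]
  simp_rw [h2]
  rw [Multiset.filter_eq_self.2]
  · rw [Fin.univ_val_map, c.ofFn_blocksFun]
    exact Multiset.sort_eq _ _
  · intro a ha
    obtain ⟨i, -, rfl⟩ := Multiset.mem_map.1 ha
    exact Nat.one_le_iff_ne_zero.1 (c.one_le_blocksFun i)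

/-- The partition of `n` formed by the sizes of the diagonal blocks of `P_J`. -/
noncomputable def blockPartition (J : Set (Fin (n - 1))) : n.Partition where
  parts := fiberSizes (blockIndex J)
  parts_pos hi := Nat.pos_of_ne_zero (Multiset.mem_filter.1 hi).2
  parts_sum := by rw [sum_fiberSizes, Nat.card_fin]

open Classical in
theorem assocDelta_partitionRoots (ν : n.Partition) (J : Set (Fin (n - 1))) :
    assocDelta n (partitionRoots ν) J = if ν = blockPartition J then 1 else 0 := by
  have h : AreAssociate n (partitionRoots ν) J ↔ ν = blockPartition J := by
    rw [areAssociate_iff, fiberSizes_blockIndex_partitionRoots, Nat.Partition.ext_iff]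
    rfl
  simp only [assocDelta, h]

end Roots

/-- The value of `springerPoly` at the partition given by the blocks of `P_J` counts the points of
the generalized Springer variety. -/
theorem springerCount_eq_eval_springerPoly (n : ℕ) (F : Type u) [Field F] [Finite F]
    (J : Set (Fin (n - 1))) :
    springerCount n F J = (springerPoly (blockPartition J)).eval (Nat.card F : ℤ) := by
  have h1 := congrArg (Nat.cast : ℕ → ℤ) (card_springerVariety_mul (F := F) J)
  have h2 := congrArg (Polynomial.eval (Nat.card F : ℤ))
    (springerPoly_mul_prod_glPoly (blockPartition J))
  have e1 : Polynomial.eval (Nat.card F : ℤ) ((blockPartition J).parts.map glPoly).prod =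
      ∏ t, (Nat.card (GL (Fin (Nat.card {a // blockIndex J a = t})) F) : ℤ) := by
    rw [blockPartition, prod_map_fiberSizes _ _ (by simp [glPoly, qFactorial]), eval_prod]
    exact Finset.prod_congr rfl fun t _ => Matrix.eval_glPoly_eq_card _
  have e2 : Polynomial.eval (Nat.card F : ℤ)
      ((blockPartition J).parts.map fun a => (X : ℤ[X]) ^ (a * a - a)).prod =
      ∏ t, (Nat.card F : ℤ) ^ (Nat.card {a // blockIndex J a = t} *
        Nat.card {a // blockIndex J a = t} - Nat.card {a // blockIndex J a = t}) := by
    rw [blockPartition, prod_map_fiberSizes _ _ (by simp), eval_prod]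
    simp
  rw [eval_mul, eval_mul, e1, e2, Matrix.eval_glPoly_eq_card] at h2
  push_cast at h1
  rw [← h2] at h1
  refine mul_right_cancel₀ (Finset.prod_ne_zero_iff.2 fun t _ => ?_) h1
  exact_mod_cast Nat.card_pos.ne'

theorem mainTheorem8 (n : ℕ) :
    ∃ (G : ℤ[X]) (S : n.Partition → ℤ[X]),
      (∀ (F : Type u) [Field F] [Finite F],
        G.eval (Nat.card F : ℤ) = Nat.card (GL (Fin n) F) ∧
        ∀ J : Set (Fin (n - 1)), springerCount n F J =
          ∑ ν : n.Partition, (S ν).eval (Nat.card F : ℤ) * assocDelta n (partitionRoots ν) J) ∧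
      plethysm (hSym ℚ n) ((RatFunc.X - 1 : RatFunc ℚ)⁻¹ • pSym (RatFunc ℚ) 1) =
        (toRatFunc G)⁻¹ • ∑ ν : n.Partition, toRatFunc (S ν) • mSym (RatFunc ℚ) ν := by
  classical
  refine ⟨glPoly n, springerPoly, fun F _ _ => ⟨Matrix.eval_glPoly_eq_card n, fun J => ?_⟩,
    plethysm_hSym_div n⟩
  rw [springerCount_eq_eval_springerPoly]
  simp [assocDelta_partitionRoots]
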